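/- **Setting.** Let $(W,\omega,L)$ be a Liouville manifold: $W$ is a smooth manifold without boundary, $\omega$ is a symplectic form and $L$ is a complete vector field with flow $\phi_L^s$ such that $\mathcal L_L\omega=\omega$, i.e. $\omega=d\lambda$ for $\lambda=\iota_L\omega$. Let $S^1=\mathbb R/\mathbb Z$ with coordinate $t$, and equip $W\times S^1$ with the contact structure $\ker(\lambda+dt)$. A *compactly supported contact isotopy* is a smooth path $\{\phi_s\}_{s\in[0,1]}$ of diffeomorphisms of $W\times S^1$ preserving $\ker(\lambda+dt)$, with $\phi_0=\mathrm{id}$, all equal to the identity outside one compact set. The compactly supported elements of $\mathrm{Cont}_0(W\times S^1)$ are the time-one maps $\phi_1$ of such isotopies. A *star-shaped domain* of $W$ is a relatively compact open set $A\subset W$ with smooth boundary to which $L$ is transverse, pointing outwards, such that $W=\bigcup_{s\ge 0}\phi_L^s(A)$. A *fiberwise star-shaped domain* of $W\times S^1$ is a relatively compact open set $U$ with smooth boundary transverse to the fibers $W\times\{t\}$, such that $U\cap(W\times\{t\})$ is a star-shaped domain of $W$ for every $t\in S^1$. For a positive integer $k$ let $\tau_k:W\times S^1\to W\times S^1$,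 $\tau_k(p,t)=(\phi_L^{\ln k}(p),kt)$, and for $U\subset W\times S^1$ put $U/k=\tau_k^{-1}(U)$. A fiberwise star-shaped domain $U$ is *squeezable* if there are positive integers $k<l$ and a compactly supported contact isotopy $\{\phi_s\}$ with $\phi_1(U/k)\subset U/l$, and *non-squeezable* otherwise; let $\mathcal N_{W\times S^1}$ be the set of non-squeezable fiberwise star-shaped domains. For subsets $U,V\subset W\times S^1$ define $$\rho_c(U,V)=\inf\Big\{\tfrac kl\ \Big|\ k,l\in\mathbb Z_{>0},\ \phi_1(U/k)\subset V/l\text{ for some compactly supported contact isotopy }\{\phi_s\}\Big\}\in[0,\infty]$$ (with $\inf\emptyset=\infty$), and $$d_{\rm CBM}(U,V)=\ln\max\{\rho_c(U,V),\rho_c(V,U)\}\in[-\infty,\infty]$$ (with $\ln 0=-\infty$, $\ln\infty=\infty$). **Theorem.** Suppose that $\mathcal N_{W\times S^1}\neq\emptyset$. Then $d_{\rm CBM}$ defines a non-trivial pseudo-metric on $\mathcal N_{W\times S^1}$: it takes finite non-negative values there, vanishes on the diagonal, is symmetric and satisfies the triangle inequality, and there are $U,V\in\mathcal N_{W\times S^1}$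 with $d_{\rm CBM}(U,V)>0$. Moreover, for all compactly supported contactomorphisms $\phi,\psi\in\mathrm{Cont}_0(W\times S^1)$ and all $U,V\in\mathcal N_{W\times S^1}$, $$d_{\rm CBM}(\phi(U),\psi(V))=d_{\rm CBM}(U,V).$$ -/

import Mathlib

open Set Topology
open scoped Manifold ContDiff ENNReal

noncomputable section

namespace ContactBM

/-- The pull-back of a 1-form `β` on `W` to the target of the chart of `W` around `x₀`:
at `y` it sends `u : E` to `β (d(chart⁻¹)_y u)`. -/
def formInChart {E : Type*} [NormedAddCommGroup E] [NormedSpace ℝ E]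
    {W : Type*} [TopologicalSpace W] [ChartedSpace E W]
    (β : ∀ x : W, TangentSpace 𝓘(ℝ, E) x →L[ℝ] ℝ) (x₀ : W) (y : E) : E →L[ℝ] ℝ :=
  (β ((chartAt E x₀).symm y)).comp (mfderiv 𝓘(ℝ, E) 𝓘(ℝ, E) (chartAt E x₀).symm y)

/-- A Liouville manifold `(W, ω, L)`: `ω` is a symplectic form and `L` is a complete vector field
with `L_L ω = ω`. Because `dω = 0`, the last identity says `ω = d(ι_L ω)`; conversely
`ω = d(ι_L ω)` gives `dω = 0` and `L_L ω = ω`. The exterior derivative is computed in charts.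
A complete smooth vector field is the infinitesimal generator of a smooth action of `ℝ`, its flow.
A finite-type condition is not needed here: it follows as soon as `W` has a star-shaped domain in
the sense of `IsStarShaped` below. -/
structure LiouvilleManifold (E : Type*) [NormedAddCommGroup E] [NormedSpace ℝ E]
    (W : Type*) [TopologicalSpace W] [ChartedSpace E W] where
  /-- the symplectic form -/
  symp : ∀ x : W, TangentSpace 𝓘(ℝ, E) x →L[ℝ] TangentSpace 𝓘(ℝ, E) x →L[ℝ] ℝ
  /-- the Liouville vector field -/
  L : ∀ x : W, TangentSpace 𝓘(ℝ, E) x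
  /-- the flow of the Liouville vector field -/
  flow : Flow ℝ W
  flow_smooth : ContMDiff (𝓘(ℝ, ℝ).prod 𝓘(ℝ, E)) 𝓘(ℝ, E) ∞ (fun q : ℝ × W => flow q.1 q.2)
  flow_generator : ∀ x : W, IsMIntegralCurve (I := 𝓘(ℝ, E)) (fun t => flow t x) L
  alternating : ∀ (x : W) (v : TangentSpace 𝓘(ℝ, E) x), symp x v v = 0
  nondegenerate : ∀ (x : W) (v : TangentSpace 𝓘(ℝ, E) x), (∀ w, symp x v w = 0) → v = 0
  /-- the 1-form `λ = ι_L ω` is smooth -/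
  form_smooth : ∀ x₀ : W,
    ContDiffOn ℝ ∞ (formInChart (fun x => symp x (L x)) x₀) (chartAt E x₀).target
  /-- `dλ = ω` in every chart, with `dλ(u, v) = ∂_u (λ v) - ∂_v (λ u)` -/
  form_deriv : ∀ x₀ : W, ∀ y ∈ (chartAt E x₀).target, ∀ u v : E,
    fderiv ℝ (formInChart (fun x => symp x (L x)) x₀) y u v
        - fderiv ℝ (formInChart (fun x => symp x (L x)) x₀) y v u
      = symp ((chartAt E x₀).symm y)
          (mfderiv 𝓘(ℝ, E) 𝓘(ℝ, E) (chartAt E x₀).symm y u)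
          (mfderiv 𝓘(ℝ, E) 𝓘(ℝ, E) (chartAt E x₀).symm y v)

/-- The form `dt` on `S¹ = ℝ/ℤ`, with `ℝ/ℤ` realised as the unit circle through
`t ↦ z = exp (2πit)`: it is `dz / (2πi z)`. -/
def dt (z : Circle) (v : TangentSpace (𝓡 1) z) : ℝ :=
  (starRingEnd ℂ (z : ℂ) * mvfderiv (𝓡 1) (fun w : Circle => (w : ℂ)) z v).im / (2 * Real.pi)

section

variable {E : Type*} [NormedAddCommGroup E] [NormedSpace ℝ E]
  {W : Type*} [TopologicalSpace W] [ChartedSpace E W]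

/-- The 1-form `λ = ι_L ω`. -/
def LiouvilleManifold.form (Λ : LiouvilleManifold E W) (p : W) :
    TangentSpace 𝓘(ℝ, E) p →L[ℝ] ℝ :=
  Λ.symp p (Λ.L p)

/-- The contact 1-form `λ + dt` on `W × S¹`. -/
def contactForm (Λ : LiouvilleManifold E W) (x : W × Circle)
    (v : TangentSpace (𝓘(ℝ, E).prod (𝓡 1)) x) : ℝ :=
  Λ.form x.1 v.1 + dt x.2 v.2

/-- The family `φ_t`, `t ∈ [0, 1]`, is a compactly supported contact isotopy of `W × S¹`: a smooth
path of diffeomorphisms that starts at the identity, preserves the contact structure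
`ker (λ + dt)`, and is the identity outside a compact set. (For `t ∉ [0, 1]` the value `φ t` is
irrelevant. The family of inverses of a smooth family of diffeomorphisms is smooth.) -/
structure IsContactIsotopy (Λ : LiouvilleManifold E W) (φ : ℝ → Equiv.Perm (W × Circle)) :
    Prop where
  smooth : ContMDiffOn (𝓘(ℝ, ℝ).prod (𝓘(ℝ, E).prod (𝓡 1))) (𝓘(ℝ, E).prod (𝓡 1)) ∞
    (fun q : ℝ × (W × Circle) => φ q.1 q.2) (Icc 0 1 ×ˢ univ)
  smooth_symm : ContMDiffOn (𝓘(ℝ, ℝ).prod (𝓘(ℝ, E).prod (𝓡 1))) (𝓘(ℝ, E).prod (𝓡 1)) ∞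
    (fun q : ℝ × (W × Circle) => (φ q.1).symm q.2) (Icc 0 1 ×ˢ univ)
  zero : ∀ x, φ 0 x = x
  contact : ∀ t ∈ Icc (0 : ℝ) 1, ∀ (x : W × Circle)
    (v : TangentSpace (𝓘(ℝ, E).prod (𝓡 1)) x),
    contactForm Λ (φ t x)
        (mfderiv (𝓘(ℝ, E).prod (𝓡 1)) (𝓘(ℝ, E).prod (𝓡 1)) (φ t) x v) = 0
      ↔ contactForm Λ x v = 0
  compact_support : ∃ K : Set (W × Circle), IsCompact K ∧
    ∀ t ∈ Icc (0 : ℝ) 1, ∀ x ∉ K, φ t x = x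

/-- `Cont₀(W × S¹)`: the compactly supported contactomorphisms that are joined to the identity by a
compactly supported contact isotopy. -/
def Cont₀ (Λ : LiouvilleManifold E W) : Set (Equiv.Perm (W × Circle)) :=
  {ψ | ∃ φ : ℝ → Equiv.Perm (W × Circle), IsContactIsotopy Λ φ ∧ φ 1 = ψ}

/-- An open star-shaped domain of `W`: it is relatively compact, has smooth boundary, `L` is
transverse to the boundary and points outwards, and every flow line of `-L` enters the domain
(equivalently, the domain and the forward flow lines of `L` from its boundary fill `W`). -/
structure IsStarShaped (Λ : LiouvilleManifold E W) (A : Set W) : Prop where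
  isOpen : IsOpen A
  isCompact_closure : IsCompact (closure A)
  boundary : ∀ p ∈ frontier A, ∃ (O : Set W) (f : W → ℝ), IsOpen O ∧ p ∈ O ∧
    ContMDiffOn 𝓘(ℝ, E) 𝓘(ℝ, ℝ) ∞ f O ∧ (∀ q ∈ O, q ∈ A ↔ f q < 0) ∧
    0 < mvfderiv 𝓘(ℝ, E) f p (Λ.L p)
  exhausts : ∀ p : W, ∃ s : ℝ, 0 ≤ s ∧ Λ.flow (-s) p ∈ A

/-- A fiberwise star-shaped domain of `W × S¹`: a relatively compact open set with smooth boundary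
transverse to the fibers `W × {z}`, whose intersection with every fiber is a star-shaped domain.
Transversality says that the differential of a local defining function of the boundary does not
vanish on the tangent space of the fiber. -/
structure IsFiberwiseStarShaped (Λ : LiouvilleManifold E W) (U : Set (W × Circle)) : Prop where
  isOpen : IsOpen U
  isCompact_closure : IsCompact (closure U)
  boundary : ∀ x ∈ frontier U, ∃ (O : Set (W × Circle)) (f : W × Circle → ℝ), IsOpen O ∧ x ∈ O ∧
    ContMDiffOn (𝓘(ℝ, E).prod (𝓡 1)) 𝓘(ℝ, ℝ) ∞ f O ∧ (∀ y ∈ O, y ∈ U ↔ f y < 0) ∧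
    ∃ v : TangentSpace 𝓘(ℝ, E) x.1, mvfderiv (𝓘(ℝ, E).prod (𝓡 1)) f x (v, 0) ≠ 0
  fiber : ∀ z : Circle, IsStarShaped Λ {p : W | (p, z) ∈ U}

/-- The covering map `τ_k (p, t) = (φ_L^{ln k} p, k t)`, where `t ↦ k t` on `ℝ/ℤ` is `z ↦ z ^ k` on
the unit circle. Used for `k ≥ 1` only. -/
def coverMap (Λ : LiouvilleManifold E W) (k : ℕ) (x : W × Circle) : W × Circle :=
  (Λ.flow (Real.log k) x.1, x.2 ^ k)

/-- The rescaling `U/k = τ_k⁻¹(U)`. -/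
def rescale (Λ : LiouvilleManifold E W) (U : Set (W × Circle)) (k : ℕ) : Set (W × Circle) :=
  coverMap Λ k ⁻¹' U

/-- Some compactly supported contact isotopy `φ` satisfies `φ_1(U/k) ⊆ V/l`. -/
def Embeds (Λ : LiouvilleManifold E W) (U V : Set (W × Circle)) (k l : ℕ) : Prop :=
  ∃ φ : ℝ → Equiv.Perm (W × Circle), IsContactIsotopy Λ φ ∧
    φ 1 '' rescale Λ U k ⊆ rescale Λ V l

/-- `U` is squeezable: `φ_1(U/k) ⊆ U/l` for some positive `k < l` and some compactly supported
contact isotopy `φ`. -/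
def IsSqueezable (Λ : LiouvilleManifold E W) (U : Set (W × Circle)) : Prop :=
  ∃ k l : ℕ, 0 < k ∧ k < l ∧ Embeds Λ U U k l

/-- The set of all non-squeezable fiberwise star-shaped domains of `W × S¹`. -/
def nonSqueezable (Λ : LiouvilleManifold E W) : Set (Set (W × Circle)) :=
  {U | IsFiberwiseStarShaped Λ U ∧ ¬ IsSqueezable Λ U}

/-- `ρ_c(U, V)`, the infimum of the `k / l` with `φ_1(U/k) ⊆ V/l` for some compactly supported
contact isotopy `φ`; it is `⊤` if there are none. -/
def rhoC (Λ : LiouvilleManifold E W) (U V : Set (W × Circle)) : ℝ≥0∞ :=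
  sInf {r | ∃ k l : ℕ, 0 < k ∧ 0 < l ∧ Embeds Λ U V k l ∧ r = (k : ℝ≥0∞) / (l : ℝ≥0∞)}

/-- `γ_CBM(U, V)`. -/
def gammaCBM (Λ : LiouvilleManifold E W) (U V : Set (W × Circle)) : ℝ≥0∞ :=
  max (rhoC Λ U V) (rhoC Λ V U)

/-- The contact Banach-Mazur distance `d_CBM(U, V) = ln γ_CBM(U, V)` with values in `[-∞, ∞]`,
where `ln 0 = -∞` and `ln ∞ = ∞`. -/
def dCBM (Λ : LiouvilleManifold E W) (U V : Set (W × Circle)) : EReal :=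
  ENNReal.log (gammaCBM Λ U V)

end

end ContactBM

end

/-! Since `dλ = ω` and `λ = ι_L ω`, the Liouville flow satisfies `φ_s^* λ = e^s λ`. Hence `τ_k`
multiplies `λ + dt` by `k` (`contactForm_coverMap`), and a contact isotopy lifts through `τ_m`: its
circle component moves points by a real angle that starts at `0`, and this angle can be divided by
`m` (`IsContactIsotopy.exists_lift`).

Lifting turns an embedding of `U/k` into `V/l` into one of `U/(km)` into `V/(lm)`. Two embeddings
with ratios `k/l` and `m/n` can therefore be brought to a common middle domain and composed, so
`ρ_c` is submultiplicative (`rhoC_triangle`). It is finite because backward flow lines enter a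
star-shaped domain for good, uniformly on compact sets.

Non-squeezability of `U` says `ρ_c(U, U) ≥ 1`, hence `ρ_c(U, V) ρ_c(V, U) ≥ 1`, and the larger
factor is at least `1`. Its logarithm is the pseudo-metric. It is non-trivial because `U/2` is again
non-squeezable and `ρ_c(U, U/2) ≥ 2`. Invariance follows by lifting `φ` and `ψ` to the rescaled
domains. -/

/-- Transport of a 1-form along a two-parameter map whose first partial derivative is annihilated by
the form. -/
theorem hasDerivAt_form_of_partial_eq_zero {E : Type*} [NormedAddCommGroup E] [NormedSpace ℝ E]
    {F : ℝ × ℝ → E} {α : E → E →L[ℝ] ℝ} {s₀ : ℝ}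
    (hF : ContDiffAt ℝ 2 F (s₀, 0)) (hα : DifferentiableAt ℝ α (F (s₀, 0)))
    (h₀ : ∀ᶠ z in 𝓝 (s₀, (0 : ℝ)), α (F z) (fderiv ℝ F z (1, 0)) = 0)
    (hd : fderiv ℝ α (F (s₀, 0)) (fderiv ℝ F (s₀, 0) (1, 0)) (fderiv ℝ F (s₀, 0) (0, 1))
        - fderiv ℝ α (F (s₀, 0)) (fderiv ℝ F (s₀, 0) (0, 1)) (fderiv ℝ F (s₀, 0) (1, 0))
      = α (F (s₀, 0)) (fderiv ℝ F (s₀, 0) (0, 1))) :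
    HasDerivAt (fun s => α (F (s, 0)) (fderiv ℝ F (s, 0) (0, 1)))
      (α (F (s₀, 0)) (fderiv ℝ F (s₀, 0) (0, 1))) s₀ := by
  set z₀ : ℝ × ℝ := (s₀, 0)
  have hF1 : HasFDerivAt F (fderiv ℝ F z₀) z₀ := (hF.differentiableAt (by norm_num)).hasFDerivAt
  have hdF : HasFDerivAt (fderiv ℝ F) (fderiv ℝ (fderiv ℝ F) z₀) z₀ :=
    ((hF.fderiv_right (m := 1) (by norm_num)).differentiableAt (by norm_num)).hasFDerivAt
  -- Symmetry of second derivatives: the mixed terms cancel, leaving `dα(∂_s F, ∂_r F)`, which `hd`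
  -- identifies with `α(∂_r F)`.
  have hsymm : fderiv ℝ (fderiv ℝ F) z₀ (1, 0) (0, 1) = fderiv ℝ (fderiv ℝ F) z₀ (0, 1) (1, 0) :=
    (hF.isSymmSndFDerivAt (by simp)).eq _ _
  have hαF : HasFDerivAt (fun z => α (F z)) ((fderiv ℝ α (F z₀)).comp (fderiv ℝ F z₀)) z₀ :=
    hα.hasFDerivAt.comp z₀ hF1
  have key : ∀ e : ℝ × ℝ, HasFDerivAt (fun z => α (F z) (fderiv ℝ F z e))
      ((α (F z₀)).comp ((fderiv ℝ (fderiv ℝ F) z₀).flip e)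
        + ((fderiv ℝ α (F z₀)).comp (fderiv ℝ F z₀)).flip (fderiv ℝ F z₀ e)) z₀ := fun e => by
    have := hαF.clm_apply (hdF.clm_apply (hasFDerivAt_const e z₀))
    convert! this using 1
    ext <;> simp
  have e0 := (key (1, 0)).unique ((hasFDerivAt_const (0 : ℝ) z₀).congr_of_eventuallyEq h₀)
  have e1 := DFunLike.congr_fun e0 (0, 1)
  have hcurve : HasDerivAt (fun s : ℝ => (s, (0 : ℝ))) (1, 0) s₀ :=
    (hasDerivAt_id s₀).prodMk (hasDerivAt_const s₀ (0 : ℝ))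
  have h2 := (key (0, 1)).comp_hasDerivAt s₀ hcurve
  convert! h2 using 1
  simp only [add_apply, ContinuousLinearMap.comp_apply,
    ContinuousLinearMap.flip_apply, zero_apply] at e1 ⊢
  rw [hsymm]
  linarith

namespace ContactBM

/-! ### The Liouville flow and the Liouville form. -/

section Flow

variable {E : Type*} [NormedAddCommGroup E] [NormedSpace ℝ E]
  {W : Type*} [TopologicalSpace W] [ChartedSpace E W]

theorem LiouvilleManifold.contMDiff_flow (Λ : LiouvilleManifold E W) (s : ℝ) :
    ContMDiff 𝓘(ℝ, E) 𝓘(ℝ, E) ∞ (Λ.flow s) :=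
  Λ.flow_smooth.comp (contMDiff_const.prodMk contMDiff_id)

theorem LiouvilleManifold.mdifferentiableAt_flow (Λ : LiouvilleManifold E W) (s : ℝ) (p : W) :
    MDifferentiableAt 𝓘(ℝ, E) 𝓘(ℝ, E) (Λ.flow s) p :=
  (Λ.contMDiff_flow s).mdifferentiable (by simp) p

variable [IsManifold 𝓘(ℝ, E) ∞ W]

/-- The derivative of a map into a manifold, recovered from its expression in a chart. -/
theorem mfderiv_chart_symm_fderiv {V : Type*} [NormedAddCommGroup V] [NormedSpace ℝ V]
    (x₀ : W) {G : V → W} {z : V}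
    (hG : MDifferentiableAt 𝓘(ℝ, V) 𝓘(ℝ, E) G z) (hz : G z ∈ (chartAt E x₀).source) (e : V) :
    (mfderiv 𝓘(ℝ, E) 𝓘(ℝ, E) (chartAt E x₀).symm (chartAt E x₀ (G z))
        (fderiv ℝ (chartAt E x₀ ∘ G) z e) : E)
      = mfderiv 𝓘(ℝ, V) 𝓘(ℝ, E) G z e := by
  have hI : IsManifold 𝓘(ℝ, E) 1 W := IsManifold.of_le (n := ∞) (by simp)
  have hc : MDifferentiableAt 𝓘(ℝ, E) 𝓘(ℝ, E) (chartAt E x₀) (G z) :=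
    (mdifferentiable_chart x₀).mdifferentiableAt hz
  have hcs : MDifferentiableAt 𝓘(ℝ, E) 𝓘(ℝ, E) (chartAt E x₀).symm ((chartAt E x₀ ∘ G) z) :=
    (mdifferentiable_chart x₀).mdifferentiableAt_symm ((chartAt E x₀).map_source hz)
  have h1 := mfderiv_comp z hcs (hc.comp z hG)
  have h2 : mfderiv 𝓘(ℝ, V) 𝓘(ℝ, E) ((chartAt E x₀).symm ∘ (chartAt E x₀ ∘ G)) z
      = mfderiv 𝓘(ℝ, V) 𝓘(ℝ, E) G z := by
    apply Filter.EventuallyEq.mfderiv_eq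
    filter_upwards [hG.continuousAt ((chartAt E x₀).open_source.mem_nhds hz)] with y hy
    exact (chartAt E x₀).left_inv hy
  rw [mfderiv_eq_fderiv] at h1
  have h3 := DFunLike.congr_fun (h1.symm.trans h2) e
  exact h3

/-- A 1-form evaluated on the velocity of a map can be computed in a chart. -/
theorem formInChart_fderiv {V : Type*} [NormedAddCommGroup V] [NormedSpace ℝ V]
    (β : ∀ x : W, TangentSpace 𝓘(ℝ, E) x →L[ℝ] ℝ) (x₀ : W) {G : V → W} {z : V}
    (hG : MDifferentiableAt 𝓘(ℝ, V) 𝓘(ℝ, E) G z) (hz : G z ∈ (chartAt E x₀).source) (e : V) :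
    formInChart β x₀ (chartAt E x₀ (G z)) (fderiv ℝ (chartAt E x₀ ∘ G) z e)
      = β (G z) (mfderiv 𝓘(ℝ, V) 𝓘(ℝ, E) G z e) := by
  have h1 : formInChart β x₀ (chartAt E x₀ (G z)) (fderiv ℝ (chartAt E x₀ ∘ G) z e)
      = (β ((chartAt E x₀).symm (chartAt E x₀ (G z))) : E →L[ℝ] ℝ)
        (mfderiv 𝓘(ℝ, V) 𝓘(ℝ, E) G z e : E) :=
    congrArg (β ((chartAt E x₀).symm (chartAt E x₀ (G z))) : E →L[ℝ] ℝ)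
      (mfderiv_chart_symm_fderiv x₀ hG hz e)
  rw [h1, (chartAt E x₀).left_inv hz]

/-- Along the flow of the Liouville field, `d/ds φ_s^* λ = φ_s^* λ`. -/
theorem LiouvilleManifold.hasDerivAt_form_flow (Λ : LiouvilleManifold E W) (p : W)
    (v : TangentSpace 𝓘(ℝ, E) p) (s₀ : ℝ) :
    HasDerivAt (fun s => Λ.form (Λ.flow s p) (mfderiv 𝓘(ℝ, E) 𝓘(ℝ, E) (Λ.flow s) p v))
      (Λ.form (Λ.flow s₀ p) (mfderiv 𝓘(ℝ, E) 𝓘(ℝ, E) (Λ.flow s₀) p v)) s₀ := by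
  have hI : IsManifold 𝓘(ℝ, E) 1 W := IsManifold.of_le (n := ∞) (by simp)
  -- a smooth curve through `p` with velocity `v`
  obtain ⟨γ, hγ, hγ0, hγv⟩ : ∃ γ : ℝ → W, ContMDiffAt 𝓘(ℝ, ℝ) 𝓘(ℝ, E) ∞ γ 0 ∧ γ 0 = p ∧
      (mfderiv 𝓘(ℝ, ℝ) 𝓘(ℝ, E) γ 0 (1 : ℝ) : E) = (v : E) := by
    let c := chartAt E p
    have hp : p ∈ c.source := mem_chart_source E p
    let w : E := mfderiv 𝓘(ℝ, E) 𝓘(ℝ, E) c p v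
    let l : ℝ → E := fun r => c p + r • w
    have hl0 : l 0 = c p := by simp [l]
    have hl : ContDiff ℝ ∞ l := contDiff_const.add (contDiff_id.smul contDiff_const)
    have hld : HasDerivAt l w 0 := by
      simpa [l] using ((hasDerivAt_id (0 : ℝ)).smul_const w).const_add (c p)
    have hcs : ContMDiffAt 𝓘(ℝ, E) 𝓘(ℝ, E) ∞ c.symm (l 0) :=
      contMDiffOn_chart_symm.contMDiffAt
        (c.open_target.mem_nhds (hl0 ▸ c.map_source hp))
    refine ⟨c.symm ∘ l, hcs.comp 0 hl.contMDiff.contMDiffAt, by simp [hl0, c.left_inv hp], ?_⟩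
    have h1 := mfderiv_comp (0 : ℝ) (hcs.mdifferentiableAt (by simp))
      (hl.contMDiff.contMDiffAt.mdifferentiableAt (x := (0 : ℝ)) (by simp))
    rw [mfderiv_eq_fderiv (f := l), hl0] at h1
    have h2 : fderiv ℝ l 0 1 = w := by simpa using hld.deriv
    have h3 := DFunLike.congr_fun ((mdifferentiable_chart p).symm_comp_deriv hp) v
    refine (DFunLike.congr_fun h1 (1 : ℝ)).trans ?_
    refine Eq.trans ?_ h3
    exact congrArg (mfderiv 𝓘(ℝ, E) 𝓘(ℝ, E) c.symm (c p) : E →L[ℝ] E) h2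
  set x₀ := Λ.flow s₀ p
  set c := chartAt E x₀
  let G : ℝ × ℝ → W := fun z => Λ.flow z.1 (γ z.2)
  have hG : ContMDiffAt 𝓘(ℝ, ℝ × ℝ) 𝓘(ℝ, E) ∞ G (s₀, 0) := by
    have h2 : ContMDiffAt 𝓘(ℝ, ℝ × ℝ) 𝓘(ℝ, E) ∞ (fun z : ℝ × ℝ => γ z.2) (s₀, 0) :=
      ContMDiffAt.comp (s₀, (0 : ℝ)) (g := γ) hγ contDiff_snd.contMDiff.contMDiffAt
    exact Λ.flow_smooth.contMDiffAt.comp (s₀, (0 : ℝ))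
      (contDiff_fst.contMDiff.contMDiffAt.prodMk h2)
  have hG0 : G (s₀, 0) = x₀ := by simp [G, hγ0, x₀]
  have hev : ∀ᶠ z in 𝓝 (s₀, (0 : ℝ)),
      MDifferentiableAt 𝓘(ℝ, ℝ × ℝ) 𝓘(ℝ, E) G z ∧ G z ∈ c.source := by
    have h1 : ∀ᶠ z in 𝓝 (s₀, (0 : ℝ)), ContMDiffAt 𝓘(ℝ, ℝ × ℝ) 𝓘(ℝ, E) 1 G z :=
      contMDiffAt_iff_contMDiffAt_nhds (by simp) |>.1 (ContMDiffAt.of_le hG (by simp))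
    filter_upwards [h1, hG.continuousAt (c.open_source.mem_nhds
      (by rw [hG0]; exact mem_chart_source E x₀))] with z hz hz'
    exact ⟨hz.mdifferentiableAt (by simp), hz'⟩
  have hF : ContDiffAt ℝ 2 (c ∘ G) (s₀, 0) := by
    have hc : ContMDiffAt 𝓘(ℝ, E) 𝓘(ℝ, E) ∞ c (G (s₀, 0)) :=
      contMDiffOn_chart.contMDiffAt
        (c.open_source.mem_nhds (by rw [hG0]; exact mem_chart_source E x₀))
    exact (hc.comp _ hG).contDiffAt.of_le (WithTop.coe_le_coe.2 le_top)
  have hspan : ∀ (T : ℝ × ℝ →L[ℝ] E) (u : ℝ × ℝ),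
      T.comp (ContinuousLinearMap.toSpanSingleton ℝ u) 1 = T u := fun T u => by simp
  have hGs : ∀ z, MDifferentiableAt 𝓘(ℝ, ℝ × ℝ) 𝓘(ℝ, E) G z →
      (mfderiv 𝓘(ℝ, ℝ × ℝ) 𝓘(ℝ, E) G z (1, 0) : E) = Λ.L (G z) := by
    rintro ⟨s, r⟩ hz
    have h1 := hz.hasMFDerivAt.comp s (hasMFDerivAt_iff_hasFDerivAt.2
      ((hasDerivAt_id s).prodMk (hasDerivAt_const s r)).hasFDerivAt)
    have h2 := hasMFDerivAt_unique h1 (Λ.flow_generator (γ r) s)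
    have h3 : ((1 : ℝ →L[ℝ] ℝ).smulRight (Λ.L (G (s, r)) : E)) 1 = Λ.L (G (s, r)) := by simp
    exact ((hspan _ _).symm.trans (DFunLike.congr_fun h2 (1 : ℝ))).trans h3
  have hGv : ∀ s, MDifferentiableAt 𝓘(ℝ, ℝ × ℝ) 𝓘(ℝ, E) G (s, 0) →
      (mfderiv 𝓘(ℝ, ℝ × ℝ) 𝓘(ℝ, E) G (s, 0) (0, 1) : E)
        = mfderiv 𝓘(ℝ, E) 𝓘(ℝ, E) (Λ.flow s) p v := by
    intro s hz
    have h1 := hz.hasMFDerivAt.comp (0 : ℝ) (hasMFDerivAt_iff_hasFDerivAt.2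
      ((hasDerivAt_const (0 : ℝ) s).prodMk (hasDerivAt_id (0 : ℝ))).hasFDerivAt)
    have h2 := (Λ.mdifferentiableAt_flow s (γ 0)).hasMFDerivAt.comp (0 : ℝ)
      (hγ.mdifferentiableAt (by simp)).hasMFDerivAt
    have h3 := DFunLike.congr_fun (hasMFDerivAt_unique h1 h2) (1 : ℝ)
    rw [hγ0] at h3
    exact (hspan _ _).symm.trans (h3.trans (congrArg
      (mfderiv 𝓘(ℝ, E) 𝓘(ℝ, E) (Λ.flow s) p : E →L[ℝ] E) hγv))
  have hform := fun z (hz : MDifferentiableAt 𝓘(ℝ, ℝ × ℝ) 𝓘(ℝ, E) G z ∧ G z ∈ c.source) e =>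
    formInChart_fderiv Λ.form x₀ hz.1 hz.2 e
  have hmem : c (G (s₀, 0)) ∈ c.target := c.map_source (by rw [hG0]; exact mem_chart_source E x₀)
  have hα : DifferentiableAt ℝ (formInChart Λ.form x₀) ((c ∘ G) (s₀, 0)) :=
    ((Λ.form_smooth x₀).contDiffAt (c.open_target.mem_nhds hmem)).differentiableAt (by simp)
  have hpt := hev.self_of_nhds
  have hL : ∀ z, MDifferentiableAt 𝓘(ℝ, ℝ × ℝ) 𝓘(ℝ, E) G z → ∀ e : ℝ × ℝ,
      Λ.symp (G z) (mfderiv 𝓘(ℝ, ℝ × ℝ) 𝓘(ℝ, E) G z (1, 0))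
        (mfderiv 𝓘(ℝ, ℝ × ℝ) 𝓘(ℝ, E) G z e)
      = Λ.form (G z) (mfderiv 𝓘(ℝ, ℝ × ℝ) 𝓘(ℝ, E) G z e) := fun z hz e =>
    congrArg (fun u : E => (Λ.symp (G z) : E →L[ℝ] E →L[ℝ] ℝ) u
      (mfderiv 𝓘(ℝ, ℝ × ℝ) 𝓘(ℝ, E) G z e : E)) (hGs z hz)
  -- The variation `G` has `∂_s G = L`. Thus `λ(∂_s G) = ω(L, L) = 0`, while `dλ = ω` gives `dλ(∂_s
  -- G, ·) = ω(L, ·) = λ`.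
  have key := hasDerivAt_form_of_partial_eq_zero (α := formInChart Λ.form x₀) hF hα
    (hev.mono fun z hz => by
      rw [Function.comp_apply, hform z hz, ← hL z hz.1, Λ.alternating]) (by
      have hd := Λ.form_deriv x₀ (c (G (s₀, 0))) hmem
        (fderiv ℝ (c ∘ G) (s₀, 0) (1, 0)) (fderiv ℝ (c ∘ G) (s₀, 0) (0, 1))
      refine hd.trans ?_
      rw [Function.comp_apply, hform _ hpt, ← hL _ hpt.1]
      have e1 := fun e => mfderiv_chart_symm_fderiv x₀ hpt.1 hpt.2 e
      refine (congrArg₂ (fun u u' : E => (Λ.symp (c.symm (c (G (s₀, 0)))) : E →L[ℝ] E →L[ℝ] ℝ) u u')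
        (e1 (1, 0)) (e1 (0, 1))).trans ?_
      rw [c.left_inv hpt.2])
  have hslice : ∀ s, MDifferentiableAt 𝓘(ℝ, ℝ × ℝ) 𝓘(ℝ, E) G (s, 0) ∧ G (s, 0) ∈ c.source →
      Λ.form (Λ.flow s p) (mfderiv 𝓘(ℝ, E) 𝓘(ℝ, E) (Λ.flow s) p v)
        = formInChart Λ.form x₀ ((c ∘ G) (s, 0)) (fderiv ℝ (c ∘ G) (s, 0) (0, 1)) := fun s hs => by
    rw [Function.comp_apply, hform _ hs]
    have h1 := congrArg (Λ.form (Λ.flow s (γ 0)) : E →L[ℝ] ℝ) (hGv s hs.1)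
    rw [hγ0] at h1
    refine h1.symm.trans ?_
    exact congrArg (fun q => (Λ.form (Λ.flow s q) : E →L[ℝ] ℝ)
      (mfderiv 𝓘(ℝ, ℝ × ℝ) 𝓘(ℝ, E) G (s, 0) (0, 1) : E)) hγ0.symm
  have hslices : ∀ᶠ s in 𝓝 s₀,
      MDifferentiableAt 𝓘(ℝ, ℝ × ℝ) 𝓘(ℝ, E) G (s, 0) ∧ G (s, 0) ∈ c.source :=
    (Continuous.prodMk_left (0 : ℝ)).continuousAt.eventually hev
  rw [hslice s₀ hpt]
  exact key.congr_of_eventuallyEq (hslices.mono hslice)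

/-- The flow of the Liouville field scales the Liouville form: `φ_s^* λ = e^s λ`. -/
theorem LiouvilleManifold.form_flow (Λ : LiouvilleManifold E W) (s : ℝ) (p : W)
    (v : TangentSpace 𝓘(ℝ, E) p) :
    Λ.form (Λ.flow s p) (mfderiv 𝓘(ℝ, E) 𝓘(ℝ, E) (Λ.flow s) p v)
      = Real.exp s * Λ.form p v := by
  set h : ℝ → ℝ := fun s =>
    Λ.form (Λ.flow s p) (mfderiv 𝓘(ℝ, E) 𝓘(ℝ, E) (Λ.flow s) p v) with hdef
  have hh : ∀ s, HasDerivAt h (h s) s := Λ.hasDerivAt_form_flow p v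
  have hg : ∀ s, HasDerivAt (fun s => Real.exp (-s) * h s) 0 s := fun s => by
    have := ((hasDerivAt_neg s).exp).mul (hh s)
    convert! this using 1
    ring
  have hconst := is_const_of_deriv_eq_zero (fun s => (hg s).differentiableAt)
    (fun s => (hg s).deriv) s 0
  have h0 : h 0 = Λ.form p v := by
    have : Λ.flow 0 = id := Λ.flow.map_zero
    simp only [hdef]
    rw [this, mfderiv_id]
    rfl
  have h1 : h s = Real.exp s * (Real.exp (-s) * h s) := by
    rw [← mul_assoc, ← Real.exp_add]; simp
  change h s = _
  rw [h1, hconst, h0]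
  simp

end Flow

end ContactBM

/-! ### Powers and real lifts on the circle. -/

theorem contMDiff_circle_pow (k : ℕ) : ContMDiff (𝓡 1) (𝓡 1) ∞ (fun z : Circle => z ^ k) :=
  (contMDiff_pow (n := ω) k).of_le le_top

theorem contMDiff_circle_coe : ContMDiff (𝓡 1) 𝓘(ℝ, ℂ) ∞ (fun z : Circle => (z : ℂ)) :=
  haveI : Fact (Module.finrank ℝ ℂ = 1 + 1) := finrank_real_complex_fact'
  contMDiff_coe_sphere (E := ℂ) (n := 1)

/-- A continuous lift through `Circle.exp` of a smooth map into the circle is smooth. -/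
theorem ContMDiffOn.of_circle_exp {E' H' : Type*} [NormedAddCommGroup E'] [NormedSpace ℝ E']
    [TopologicalSpace H'] {I : ModelWithCorners ℝ E' H'} {N : Type*} [TopologicalSpace N]
    [ChartedSpace H' N] {s : Set N} {u : N → Circle} {θ : N → ℝ}
    (hu : ContMDiffOn I (𝓡 1) ∞ u s) (hθ : ContinuousOn θ s)
    (h : ∀ x ∈ s, Circle.exp (θ x) = u x) : ContMDiffOn I 𝓘(ℝ, ℝ) ∞ θ s := by
  intro x₀ hx₀
  -- Near `u x₀` the quotient `w / u x₀` is close to `1`, where the principal logarithm is smooth.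
  -- Its imaginary part recovers the change of `θ` as long as that change is less than `π`.
  have hlog : ContDiffAt ℝ ∞ (fun w : ℂ => θ x₀ + (Complex.log (w / (u x₀ : ℂ))).im)
      (u x₀ : ℂ) := by
    have h1 : ContDiffAt ℂ ∞ Complex.log ((u x₀ : ℂ) / (u x₀ : ℂ)) := by
      apply Complex.contDiffAt_log
      simp
    have h2 : ContDiffAt ℝ ∞ (fun w : ℂ => Complex.log (w / (u x₀ : ℂ))) (u x₀ : ℂ) :=
      ContDiffAt.comp (u x₀ : ℂ) (f := fun w : ℂ => w / (u x₀ : ℂ)) (h1.restrict_scalars ℝ)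
        (contDiffAt_id.div_const _)
    exact contDiffAt_const.add (Complex.imCLM.contDiff.contDiffAt.comp (u x₀ : ℂ) h2)
  have hcomp : ContMDiffWithinAt I 𝓘(ℝ, ℝ) ∞
      (fun x => θ x₀ + (Complex.log ((u x : ℂ) / (u x₀ : ℂ))).im) s x₀ :=
    ContMDiffAt.comp_contMDiffWithinAt x₀ (f := fun x => (u x : ℂ)) hlog.contMDiffAt
      (contMDiff_circle_coe.contMDiffAt.comp_contMDiffWithinAt x₀ (hu x₀ hx₀))
  have key : ∀ x ∈ s, |θ x - θ x₀| < Real.pi →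
      θ x = θ x₀ + (Complex.log ((u x : ℂ) / (u x₀ : ℂ))).im := by
    intro x hx hlt
    rw [abs_lt] at hlt
    rw [← h x hx, ← h x₀ hx₀, ← Circle.coe_div, ← Circle.exp_sub, Complex.log_im,
      Circle.arg_exp hlt.1 hlt.2.le]
    ring
  refine hcomp.congr_of_eventuallyEq ?_ (key x₀ hx₀ (by simpa using Real.pi_pos))
  have hnear : ∀ᶠ x in 𝓝[s] x₀, |θ x - θ x₀| < Real.pi :=
    (hθ x₀ hx₀).eventually (Metric.ball_mem_nhds (θ x₀) Real.pi_pos)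
  filter_upwards [hnear, self_mem_nhdsWithin] with x hx hxs
  exact key x hxs hx

namespace ContactBM

/-- Up to the factor `2π`, `dt` is the imaginary part of `conj z · dz`. Differentiate `z ^ k` in `ℂ`
and use `conj z · z = 1`. -/
theorem dt_pow (k : ℕ) (z : Circle) (v : TangentSpace (𝓡 1) z) :
    dt (z ^ k) (mfderiv (𝓡 1) (𝓡 1) (fun w : Circle => w ^ k) z v) = k * dt z v := by
  have hc : ∀ w : Circle, MDifferentiableAt (𝓡 1) 𝓘(ℝ, ℂ) (fun z : Circle => (z : ℂ)) w :=
    contMDiff_circle_coe.mdifferentiable (by simp)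
  let D : ∀ w : Circle, EuclideanSpace ℝ (Fin 1) →L[ℝ] ℂ :=
    fun w => mfderiv (𝓡 1) 𝓘(ℝ, ℂ) (fun z : Circle => (z : ℂ)) w
  have h1 := (hc (z ^ k)).hasMFDerivAt.comp z
    ((contMDiff_circle_pow k).mdifferentiable (by simp) z).hasMFDerivAt
  have hp : HasFDerivAt (fun u : ℂ => u ^ k)
      (((k : ℂ) * (z : ℂ) ^ (k - 1)) • (1 : ℂ →L[ℝ] ℂ)) (z : ℂ) := by
    have := ((hasDerivAt_pow k (z : ℂ)).hasFDerivAt.restrictScalars ℝ)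
    convert! this using 1
    ext
    simp [mul_comm]
  have h2 := (hasMFDerivAt_iff_hasFDerivAt.2 hp).comp z (hc z).hasMFDerivAt
  have h12 : (fun z : Circle => (z : ℂ)) ∘ (fun w : Circle => w ^ k)
      = (fun u : ℂ => u ^ k) ∘ (fun z : Circle => (z : ℂ)) := by
    funext w; simp
  rw [h12] at h1
  have h3 : D (z ^ k) (mfderiv (𝓡 1) (𝓡 1) (fun w : Circle => w ^ k) z v)
      = ((k : ℂ) * (z : ℂ) ^ (k - 1)) * D z v :=
    DFunLike.congr_fun (hasMFDerivAt_unique h1 h2) v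
  have hd : ∀ (w : Circle) (u : TangentSpace (𝓡 1) w),
      dt w u = (starRingEnd ℂ (w : ℂ) * D w u).im / (2 * Real.pi) := fun _ _ => rfl
  rw [hd, hd, h3]
  have h4 : starRingEnd ℂ ((z ^ k : Circle) : ℂ) * ((k : ℂ) * (z : ℂ) ^ (k - 1))
      = k * starRingEnd ℂ (z : ℂ) := by
    -- For `k = 0` the factor `k` kills both sides, so the truncated exponent `k - 1` is harmless.
    rcases k with _ | k
    · simp
    · have hz : starRingEnd ℂ (z : ℂ) * (z : ℂ) = 1 := by
        rw [← Circle.coe_inv_eq_conj, ← Circle.coe_mul]; simp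
      have hz' : starRingEnd ℂ (z : ℂ) ^ k * (z : ℂ) ^ k = 1 := by rw [← mul_pow, hz, one_pow]
      rw [Circle.coe_pow, map_pow, Nat.add_sub_cancel, pow_succ]
      linear_combination ((k + 1 : ℕ) : ℂ) * starRingEnd ℂ (z : ℂ) * hz'
  rw [← mul_assoc, h4, mul_assoc, ← nsmul_eq_mul, Complex.im_nsmul, nsmul_eq_mul]
  ring

/-! ### The covering maps `τ_k`. -/

section CoverMap

variable {E : Type*} [NormedAddCommGroup E] [NormedSpace ℝ E]
  {W : Type*} [TopologicalSpace W] [ChartedSpace E W]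

theorem contMDiff_coverMap (Λ : LiouvilleManifold E W) (k : ℕ) :
    ContMDiff (𝓘(ℝ, E).prod (𝓡 1)) (𝓘(ℝ, E).prod (𝓡 1)) ∞ (coverMap Λ k) :=
  (Λ.contMDiff_flow (Real.log k)).prodMap (contMDiff_circle_pow k)

theorem mdifferentiableAt_coverMap (Λ : LiouvilleManifold E W) (k : ℕ) (x : W × Circle) :
    MDifferentiableAt (𝓘(ℝ, E).prod (𝓡 1)) (𝓘(ℝ, E).prod (𝓡 1)) (coverMap Λ k) x :=
  (contMDiff_coverMap Λ k).mdifferentiable (by simp) x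

theorem continuous_coverMap (Λ : LiouvilleManifold E W) (k : ℕ) : Continuous (coverMap Λ k) :=
  (contMDiff_coverMap Λ k).continuous

theorem mfderiv_coverMap (Λ : LiouvilleManifold E W) (k : ℕ) (x : W × Circle)
    (v : TangentSpace (𝓘(ℝ, E).prod (𝓡 1)) x) :
    (mfderiv (𝓘(ℝ, E).prod (𝓡 1)) (𝓘(ℝ, E).prod (𝓡 1)) (coverMap Λ k) x v
        : E × EuclideanSpace ℝ (Fin 1))
      = (mfderiv 𝓘(ℝ, E) 𝓘(ℝ, E) (Λ.flow (Real.log k)) x.1 v.1,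
          mfderiv (𝓡 1) (𝓡 1) (fun w : Circle => w ^ k) x.2 v.2) :=
  DFunLike.congr_fun (mfderiv_prodMap (Λ.mdifferentiableAt_flow (Real.log k) x.1)
    ((contMDiff_circle_pow k).mdifferentiable (by simp) x.2)) v

theorem coverMap_mul (Λ : LiouvilleManifold E W) {k l : ℕ} (hk : 0 < k) (hl : 0 < l)
    (x : W × Circle) : coverMap Λ k (coverMap Λ l x) = coverMap Λ (k * l) x := by
  have hk' : (k : ℝ) ≠ 0 := by positivity
  have hl' : (l : ℝ) ≠ 0 := by positivity
  simp only [coverMap]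
  rw [← Λ.flow.map_add, Nat.cast_mul, Real.log_mul hk' hl', ← pow_mul, mul_comm l k]

theorem rescale_mul (Λ : LiouvilleManifold E W) (U : Set (W × Circle)) {k l : ℕ} (hk : 0 < k)
    (hl : 0 < l) : rescale Λ (rescale Λ U k) l = rescale Λ U (k * l) := by
  ext x
  simp only [rescale, mem_preimage, coverMap_mul Λ hk hl]

theorem coverMap_one (Λ : LiouvilleManifold E W) (x : W × Circle) : coverMap Λ 1 x = x := by
  simp [coverMap]

theorem rescale_one (Λ : LiouvilleManifold E W) (U : Set (W × Circle)) : rescale Λ U 1 = U := by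
  ext x
  simp [rescale, coverMap_one]

theorem isCompact_preimage_coverMap (Λ : LiouvilleManifold E W) (k : ℕ) {K : Set (W × Circle)}
    (hK : IsCompact K) (hK' : IsClosed K) : IsCompact (coverMap Λ k ⁻¹' K) := by
  have h1 : IsCompact ((Λ.flow (-Real.log k) '' (Prod.fst '' K)) ×ˢ (univ : Set Circle)) :=
    ((hK.image continuous_fst).image (Λ.contMDiff_flow _).continuous).prod isCompact_univ
  refine h1.of_isClosed_subset (hK'.preimage (continuous_coverMap Λ k)) fun x hx => ⟨?_, trivial⟩
  refine ⟨Λ.flow (Real.log k) x.1, ⟨_, hx, rfl⟩, ?_⟩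
  rw [← Λ.flow.map_add]
  simp

/-- The flow time `ln k` is chosen so that `λ` is scaled by `e^{ln k} = k`, the same factor by which
`z ↦ z ^ k` scales `dt`. -/
theorem contactForm_coverMap [IsManifold 𝓘(ℝ, E) ∞ W] (Λ : LiouvilleManifold E W) {k : ℕ}
    (hk : 0 < k) (x : W × Circle) (v : TangentSpace (𝓘(ℝ, E).prod (𝓡 1)) x) :
    contactForm Λ (coverMap Λ k x)
        (mfderiv (𝓘(ℝ, E).prod (𝓡 1)) (𝓘(ℝ, E).prod (𝓡 1)) (coverMap Λ k) x v)
      = k * contactForm Λ x v := by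
  refine (congrArg (fun u : E × EuclideanSpace ℝ (Fin 1) => contactForm Λ (coverMap Λ k x) u)
    (mfderiv_coverMap Λ k x v)).trans ?_
  have h1 := Λ.form_flow (Real.log k) x.1 v.1
  rw [Real.exp_log (by positivity)] at h1
  have h2 := dt_pow k x.2 v.2
  refine (congrArg₂ (· + ·) h1 h2).trans ?_
  simp only [contactForm]
  ring

end CoverMap

/-! ### Contact isotopies and their lifts through `τ_m`. -/

section Isotopy

variable {E : Type*} [NormedAddCommGroup E] [NormedSpace ℝ E]
  {W : Type*} [TopologicalSpace W] [ChartedSpace E W] {Λ : LiouvilleManifold E W}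

/-- The map `f` preserves the hyperplane field `ker (λ + dt)`. -/
def PreservesContact (Λ : LiouvilleManifold E W) (f : W × Circle → W × Circle) : Prop :=
  ∀ (x : W × Circle) (v : TangentSpace (𝓘(ℝ, E).prod (𝓡 1)) x),
    contactForm Λ (f x) (mfderiv (𝓘(ℝ, E).prod (𝓡 1)) (𝓘(ℝ, E).prod (𝓡 1)) f x v) = 0
      ↔ contactForm Λ x v = 0

theorem mfderiv_comp_apply_of_mdifferentiable {f g : W × Circle → W × Circle}
    (hg : MDifferentiable (𝓘(ℝ, E).prod (𝓡 1)) (𝓘(ℝ, E).prod (𝓡 1)) g)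
    (hf : MDifferentiable (𝓘(ℝ, E).prod (𝓡 1)) (𝓘(ℝ, E).prod (𝓡 1)) f)
    (x : W × Circle) (v : TangentSpace (𝓘(ℝ, E).prod (𝓡 1)) x) :
    mfderiv (𝓘(ℝ, E).prod (𝓡 1)) (𝓘(ℝ, E).prod (𝓡 1)) (fun y => g (f y)) x v
      = mfderiv (𝓘(ℝ, E).prod (𝓡 1)) (𝓘(ℝ, E).prod (𝓡 1)) g (f x)
        (mfderiv (𝓘(ℝ, E).prod (𝓡 1)) (𝓘(ℝ, E).prod (𝓡 1)) f x v) :=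
  DFunLike.congr_fun (mfderiv_comp x (hg (f x)) (hf x)) v

theorem PreservesContact.comp {f g : W × Circle → W × Circle}
    (hg : PreservesContact Λ g) (hf : PreservesContact Λ f)
    (hg' : MDifferentiable (𝓘(ℝ, E).prod (𝓡 1)) (𝓘(ℝ, E).prod (𝓡 1)) g)
    (hf' : MDifferentiable (𝓘(ℝ, E).prod (𝓡 1)) (𝓘(ℝ, E).prod (𝓡 1)) f) :
    PreservesContact Λ (fun y => g (f y)) := fun x v => by
  rw [mfderiv_comp_apply_of_mdifferentiable hg' hf']
  exact (hg _ _).trans (hf x v)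

theorem preservesContact_id : PreservesContact Λ (fun x => x) := fun x v => by
  have h : mfderiv (𝓘(ℝ, E).prod (𝓡 1)) (𝓘(ℝ, E).prod (𝓡 1)) (fun x : W × Circle => x) x
      = ContinuousLinearMap.id ℝ _ := mfderiv_id
  rw [h]
  rfl

/-- If `g` and `g ∘ f` preserve the contact structure, so does `f`. -/
theorem PreservesContact.of_comp {f g : W × Circle → W × Circle}
    (hg : PreservesContact Λ g) (hgf : PreservesContact Λ (fun y => g (f y)))
    (hg' : MDifferentiable (𝓘(ℝ, E).prod (𝓡 1)) (𝓘(ℝ, E).prod (𝓡 1)) g)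
    (hf' : MDifferentiable (𝓘(ℝ, E).prod (𝓡 1)) (𝓘(ℝ, E).prod (𝓡 1)) f) :
    PreservesContact Λ f := fun x v => by
  have h := hgf x v
  rw [mfderiv_comp_apply_of_mdifferentiable hg' hf'] at h
  exact (hg _ _).symm.trans h

theorem preservesContact_coverMap [IsManifold 𝓘(ℝ, E) ∞ W] {k : ℕ} (hk : 0 < k) :
    PreservesContact Λ (coverMap Λ k) := fun x v => by
  rw [contactForm_coverMap Λ hk]
  have : (k : ℝ) ≠ 0 := by positivity
  simp [this]

theorem IsContactIsotopy.contMDiff {φ : ℝ → Equiv.Perm (W × Circle)} (h : IsContactIsotopy Λ φ)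
    {t : ℝ} (ht : t ∈ Icc (0 : ℝ) 1) :
    ContMDiff (𝓘(ℝ, E).prod (𝓡 1)) (𝓘(ℝ, E).prod (𝓡 1)) ∞ (φ t) :=
  contMDiffOn_univ.1 (h.smooth.comp (contMDiff_const.prodMk contMDiff_id).contMDiffOn
    fun _ _ => ⟨ht, trivial⟩)

theorem IsContactIsotopy.contMDiff_symm {φ : ℝ → Equiv.Perm (W × Circle)}
    (h : IsContactIsotopy Λ φ) {t : ℝ} (ht : t ∈ Icc (0 : ℝ) 1) :
    ContMDiff (𝓘(ℝ, E).prod (𝓡 1)) (𝓘(ℝ, E).prod (𝓡 1)) ∞ (φ t).symm :=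
  contMDiffOn_univ.1 (h.smooth_symm.comp (contMDiff_const.prodMk contMDiff_id).contMDiffOn
    fun _ _ => ⟨ht, trivial⟩)

theorem isContactIsotopy_one : IsContactIsotopy Λ (fun _ => 1) where
  smooth := contMDiff_snd.contMDiffOn
  smooth_symm := contMDiff_snd.contMDiffOn
  zero _ := rfl
  contact _ _ := preservesContact_id
  compact_support := ⟨∅, isCompact_empty, fun _ _ _ _ => rfl⟩

theorem IsContactIsotopy.mul {φ ψ : ℝ → Equiv.Perm (W × Circle)} (hψ : IsContactIsotopy Λ ψ)
    (hφ : IsContactIsotopy Λ φ) : IsContactIsotopy Λ (fun t => ψ t * φ t) where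
  smooth := hψ.smooth.comp (contMDiff_fst.contMDiffOn.prodMk hφ.smooth)
    fun _ hq => ⟨hq.1, trivial⟩
  smooth_symm := hφ.smooth_symm.comp (contMDiff_fst.contMDiffOn.prodMk hψ.smooth_symm)
    fun _ hq => ⟨hq.1, trivial⟩
  zero x := by simp [hφ.zero, hψ.zero]
  contact t ht := PreservesContact.comp (g := ψ t) (f := φ t) (hψ.contact t ht) (hφ.contact t ht)
    ((hψ.contMDiff ht).mdifferentiable (by simp)) ((hφ.contMDiff ht).mdifferentiable (by simp))
  compact_support := by
    obtain ⟨K, hK, h⟩ := hφ.compact_support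
    obtain ⟨K', hK', h'⟩ := hψ.compact_support
    refine ⟨K ∪ K', hK.union hK', fun t ht x hx => ?_⟩
    rw [Equiv.Perm.mul_apply, h t ht x fun hxK => hx (.inl hxK), h' t ht x fun hxK => hx (.inr hxK)]

theorem IsContactIsotopy.inv {φ : ℝ → Equiv.Perm (W × Circle)} (hφ : IsContactIsotopy Λ φ) :
    IsContactIsotopy Λ (fun t => (φ t)⁻¹) where
  smooth := hφ.smooth_symm
  smooth_symm := hφ.smooth
  zero x := Equiv.Perm.inv_eq_iff_eq.2 (hφ.zero x).symm
  contact t ht := PreservesContact.of_comp (hφ.contact t ht)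
    (by simpa using preservesContact_id) ((hφ.contMDiff ht).mdifferentiable (by simp))
    ((hφ.contMDiff_symm ht).mdifferentiable (by simp))
  compact_support := by
    obtain ⟨K, hK, h⟩ := hφ.compact_support
    exact ⟨K, hK, fun t ht x hx => Equiv.Perm.inv_eq_iff_eq.2 (h t ht x hx).symm⟩

/-- The circle component of a contact isotopy moves points by a continuous real angle. -/
theorem IsContactIsotopy.exists_angle {φ : ℝ → Equiv.Perm (W × Circle)}
    (hφ : IsContactIsotopy Λ φ) : ∃ θ : ℝ × (W × Circle) → ℝ,
      ContMDiffOn (𝓘(ℝ, ℝ).prod (𝓘(ℝ, E).prod (𝓡 1))) 𝓘(ℝ, ℝ) ∞ θ (Icc 0 1 ×ˢ univ) ∧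
      (∀ t ∈ Icc (0 : ℝ) 1, ∀ x, (φ t x).2 = x.2 * Circle.exp (θ (t, x))) ∧
      (∀ x, θ (0, x) = 0) ∧
      ∀ x, (∀ t ∈ Icc (0 : ℝ) 1, φ t x = x) → ∀ t ∈ Icc (0 : ℝ) 1, θ (t, x) = 0 := by
  let u : ℝ × (W × Circle) → Circle := fun q => (φ q.1 q.2).2 / q.2.2
  have hu : ContMDiffOn (𝓘(ℝ, ℝ).prod (𝓘(ℝ, E).prod (𝓡 1))) (𝓡 1) ∞ u (Icc 0 1 ×ˢ univ) := by
    have : LieGroup (𝓡 1) ∞ Circle := LieGroup.of_le (n := ω) le_top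
    exact (contMDiff_snd.comp_contMDiffOn hφ.smooth).div
      (contMDiff_snd.comp contMDiff_snd).contMDiffOn
  -- The displacement `u` is a homotopy starting at the constant `1`; lift it through `Circle.exp`
  -- from the constant `0`.
  let H : C(unitInterval × (W × Circle), Circle) :=
    ⟨fun q => u (q.1, q.2), hu.continuousOn.comp_continuous (by fun_prop)
      fun q => ⟨q.1.2, trivial⟩⟩
  have H0 : ∀ x, H (0, x) = Circle.exp ((ContinuousMap.const _ 0 : C(W × Circle, ℝ)) x) :=
    fun x => by simp [H, u, hφ.zero]
  let Θ := Circle.isCoveringMap_exp.liftHomotopy H _ H0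
  have hΘ : ∀ q, Circle.exp (Θ q) = H q := fun q =>
    congrFun (Circle.isCoveringMap_exp.liftHomotopy_lifts H _ H0) q
  have hΘ0 : ∀ x, Θ (0, x) = 0 := Circle.isCoveringMap_exp.liftHomotopy_zero H _ H0
  let θ : ℝ × (W × Circle) → ℝ := fun q => Θ (projIcc 0 1 zero_le_one q.1, q.2)
  have hθc : Continuous θ := Θ.continuous.comp
    ((continuous_projIcc.comp continuous_fst).prodMk continuous_snd)
  have hθu : ∀ q ∈ Icc (0 : ℝ) 1 ×ˢ (univ : Set (W × Circle)), Circle.exp (θ q) = u q := by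
    rintro ⟨t, x⟩ ⟨ht, -⟩
    simp only [θ]
    rw [projIcc_of_mem zero_le_one ht, hΘ]
    rfl
  have hθ0 : ∀ x, θ (0, x) = 0 := fun x => by
    simp only [θ]
    rw [projIcc_left]
    exact hΘ0 x
  refine ⟨θ, hu.of_circle_exp hθc.continuousOn hθu, fun t ht x => ?_, hθ0, fun x hx t ht => ?_⟩
  · rw [hθu (t, x) ⟨ht, trivial⟩]
    simp [u]
  -- Along a stationary point the displacement stays `1`, so its continuous lift is constant. This
  -- later yields compact support of the lifted isotopy.
  · have hc : Continuous fun s : unitInterval => Θ (s, x) := by fun_prop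
    have hconst := Circle.isCoveringMap_exp.const_of_comp hc
      (fun s s' => by
        rw [hΘ, hΘ]
        simp [H, u, hx s s.2, hx s' s'.2]) ⟨t, ht⟩ 0
    rw [hΘ0] at hconst
    simp only [θ]
    rw [projIcc_of_mem zero_le_one ht, hconst]

/-- A contact isotopy lifts through the covering `coverMap Λ m`. -/
theorem IsContactIsotopy.exists_lift [T2Space W] [IsManifold 𝓘(ℝ, E) ∞ W]
    {φ : ℝ → Equiv.Perm (W × Circle)} (hφ : IsContactIsotopy Λ φ) {m : ℕ} (hm : 0 < m) :
    ∃ φ' : ℝ → Equiv.Perm (W × Circle), IsContactIsotopy Λ φ' ∧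
      ∀ x, coverMap Λ m (φ' 1 x) = φ 1 (coverMap Λ m x) := by
  obtain ⟨θ, hθs, hθ, hθ0, hθK⟩ := hφ.exists_angle
  have hm' : (m : ℝ) ≠ 0 := by positivity
  let δ : ℝ := Real.log m
  -- The lift conjugates the `W` component by the flow and rotates by the angle over `m`, whose
  -- `m`-th power is the original rotation. Its inverse `b` undoes this rotation, so it reads the
  -- angle at the preimage point.
  let a : ℝ → W × Circle → W × Circle := fun t x =>
    (Λ.flow (-δ) (φ t (coverMap Λ m x)).1, x.2 * Circle.exp (θ (t, coverMap Λ m x) / m))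
  let b : ℝ → W × Circle → W × Circle := fun t x =>
    (Λ.flow (-δ) ((φ t).symm (coverMap Λ m x)).1,
      x.2 * Circle.exp (-(θ (t, (φ t).symm (coverMap Λ m x)) / m)))
  have hflow : ∀ p, Λ.flow δ (Λ.flow (-δ) p) = p := fun p => by
    rw [← Λ.flow.map_add]; simp
  have hflow' : ∀ p, Λ.flow (-δ) (Λ.flow δ p) = p := fun p => by
    rw [← Λ.flow.map_add]; simp
  have hexp : ∀ r : ℝ, Circle.exp (r / m) ^ m = Circle.exp r := fun r => by
    rw [← Circle.exp_nsmul]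
    congr 1
    rw [nsmul_eq_mul]
    field_simp
  have ha : ∀ t ∈ Icc (0 : ℝ) 1, ∀ x, coverMap Λ m (a t x) = φ t (coverMap Λ m x) := by
    intro t ht x
    refine Prod.ext (hflow _) ?_
    rw [hθ t ht]
    simp only [coverMap, a, mul_pow, hexp]
  have hb : ∀ t ∈ Icc (0 : ℝ) 1, ∀ x, coverMap Λ m (b t x) = (φ t).symm (coverMap Λ m x) := by
    intro t ht x
    refine Prod.ext (hflow _) ?_
    have h1 := hθ t ht ((φ t).symm (coverMap Λ m x))
    rw [Equiv.apply_symm_apply] at h1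
    have h2 : (coverMap Λ m (b t x)).2 = (coverMap Λ m x).2
        * Circle.exp (-(θ (t, (φ t).symm (coverMap Λ m x)))) := by
      simp only [coverMap, b, mul_pow, ← neg_div, hexp]
    rw [h2, h1, mul_assoc, ← Circle.exp_add]
    simp
  have hba : ∀ t ∈ Icc (0 : ℝ) 1, ∀ x, b t (a t x) = x := by
    intro t ht x
    have h1 : (φ t).symm (coverMap Λ m (a t x)) = coverMap Λ m x := by rw [ha t ht]; simp
    have h2 : b t (a t x) = (Λ.flow (-δ) (coverMap Λ m x).1,
        (a t x).2 * Circle.exp (-(θ (t, coverMap Λ m x) / m))) := by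
      simp only [b, h1]
    rw [h2]
    refine Prod.ext (hflow' _) ?_
    simp only [a]
    rw [mul_assoc, ← Circle.exp_add]
    simp
  have hab : ∀ t ∈ Icc (0 : ℝ) 1, ∀ x, a t (b t x) = x := by
    intro t ht x
    have h2 : a t (b t x) = (Λ.flow (-δ) (coverMap Λ m x).1,
        (b t x).2 * Circle.exp (θ (t, (φ t).symm (coverMap Λ m x)) / m)) := by
      simp only [a, hb t ht x, Equiv.apply_symm_apply]
    rw [h2]
    refine Prod.ext (hflow' _) ?_
    simp only [b]
    rw [mul_assoc, ← Circle.exp_add]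
    simp
  classical
  let φ' : ℝ → Equiv.Perm (W × Circle) := fun t =>
    if ht : t ∈ Icc (0 : ℝ) 1 then ⟨a t, b t, hba t ht, hab t ht⟩ else 1
  have hφ' : ∀ t ∈ Icc (0 : ℝ) 1, ∀ x, φ' t x = a t x := fun t ht x => by
    simp only [φ', dif_pos ht]; rfl
  have hφs : ∀ t ∈ Icc (0 : ℝ) 1, ∀ x, (φ' t).symm x = b t x := fun t ht x => by
    simp only [φ', dif_pos ht]; rfl
  have hτ : ContMDiffOn (𝓘(ℝ, ℝ).prod (𝓘(ℝ, E).prod (𝓡 1)))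
      (𝓘(ℝ, ℝ).prod (𝓘(ℝ, E).prod (𝓡 1))) ∞
      (fun q : ℝ × (W × Circle) => (q.1, coverMap Λ m q.2)) (Icc 0 1 ×ˢ univ) :=
    (contMDiff_fst.prodMk ((contMDiff_coverMap Λ m).comp contMDiff_snd)).contMDiffOn
  have hmaps : MapsTo (fun q : ℝ × (W × Circle) => (q.1, coverMap Λ m q.2))
      (Icc 0 1 ×ˢ univ) (Icc 0 1 ×ˢ univ) := fun q hq => ⟨hq.1, trivial⟩
  have hz : ContMDiffOn (𝓘(ℝ, ℝ).prod (𝓘(ℝ, E).prod (𝓡 1))) (𝓡 1) ∞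
      (fun q : ℝ × (W × Circle) => q.2.2) (Icc 0 1 ×ˢ univ) :=
    (contMDiff_snd.comp contMDiff_snd).contMDiffOn
  have : LieGroup (𝓡 1) ∞ Circle := LieGroup.of_le (n := ω) le_top
  have hφτ := hφ.smooth.comp hτ hmaps
  have hφτ' := hφ.smooth_symm.comp hτ hmaps
  have hsm : ContMDiffOn (𝓘(ℝ, ℝ).prod (𝓘(ℝ, E).prod (𝓡 1))) (𝓘(ℝ, E).prod (𝓡 1)) ∞
      (fun q : ℝ × (W × Circle) => a q.1 q.2) (Icc 0 1 ×ˢ univ) :=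
    ((Λ.contMDiff_flow (-δ)).comp_contMDiffOn (contMDiff_fst.comp_contMDiffOn hφτ)).prodMk
      (hz.mul (contMDiff_circleExp.comp_contMDiffOn
        ((contDiff_id.div_const (m : ℝ)).contMDiff.comp_contMDiffOn (hθs.comp hτ hmaps))))
  have hsm' : ContMDiffOn (𝓘(ℝ, ℝ).prod (𝓘(ℝ, E).prod (𝓡 1))) (𝓘(ℝ, E).prod (𝓡 1)) ∞
      (fun q : ℝ × (W × Circle) => b q.1 q.2) (Icc 0 1 ×ˢ univ) :=
    ((Λ.contMDiff_flow (-δ)).comp_contMDiffOn (contMDiff_fst.comp_contMDiffOn hφτ')).prodMk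
      (hz.mul (contMDiff_circleExp.comp_contMDiffOn
        ((contDiff_id.div_const (m : ℝ)).neg.contMDiff.comp_contMDiffOn
          (hθs.comp (contMDiff_fst.contMDiffOn.prodMk hφτ') fun q hq => ⟨hq.1, trivial⟩))))
  have hsmooth : ContMDiffOn (𝓘(ℝ, ℝ).prod (𝓘(ℝ, E).prod (𝓡 1))) (𝓘(ℝ, E).prod (𝓡 1)) ∞
      (fun q : ℝ × (W × Circle) => φ' q.1 q.2) (Icc 0 1 ×ˢ univ) :=
    hsm.congr fun q hq => hφ' q.1 hq.1 q.2
  refine ⟨φ', ⟨hsmooth, hsm'.congr fun q hq => hφs q.1 hq.1 q.2, fun x => ?_, fun t ht => ?_, ?_⟩,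
    fun x => ?_⟩
  · rw [hφ' 0 (by simp)]
    refine Prod.ext ?_ ?_
    · simp only [a, hφ.zero]
      exact hflow' _
    · simp [a, hθ0]
  · have hd : MDifferentiable (𝓘(ℝ, E).prod (𝓡 1)) (𝓘(ℝ, E).prod (𝓡 1)) (φ' t) :=
      (contMDiffOn_univ.1 (hsmooth.comp (contMDiff_const.prodMk contMDiff_id).contMDiffOn
        fun _ _ => ⟨ht, trivial⟩)).mdifferentiable (by simp)
    have hcov : MDifferentiable (𝓘(ℝ, E).prod (𝓡 1)) (𝓘(ℝ, E).prod (𝓡 1)) (coverMap Λ m) :=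
      fun x => mdifferentiableAt_coverMap Λ m x
    -- Both `τ_m` and `τ_m ∘ φ'_t = φ_t ∘ τ_m` preserve the contact structure, hence so does `φ'_t`.
    refine PreservesContact.of_comp (f := φ' t) (preservesContact_coverMap hm) ?_ hcov hd
    have : (fun y => coverMap Λ m (φ' t y)) = fun y => φ t (coverMap Λ m y) := by
      funext y; rw [hφ' t ht, ha t ht]
    rw [this]
    exact PreservesContact.comp (g := φ t) (hφ.contact t ht) (preservesContact_coverMap hm)
      ((hφ.contMDiff ht).mdifferentiable (by simp)) hcov
  · obtain ⟨K, hK, h⟩ := hφ.compact_support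
    refine ⟨_, isCompact_preimage_coverMap Λ m hK hK.isClosed, fun t ht x hx => ?_⟩
    rw [hφ' t ht]
    refine Prod.ext ?_ ?_
    · simp only [a, h t ht _ hx]
      exact hflow' _
    · simp [a, hθK _ (fun s hs => h s hs _ hx) t ht]
  · rw [hφ' 1 (by simp), ha 1 (by simp)]

end Isotopy

/-! ### Star-shaped domains under the flow and under rescaling. -/

section StarShaped

variable {E : Type*} [NormedAddCommGroup E] [NormedSpace ℝ E]
  {W : Type*} [TopologicalSpace W] [ChartedSpace E W] {Λ : LiouvilleManifold E W}

/-- Differentiate `φ_s ∘ φ_t = φ_t ∘ φ_s` in `t` at `t = 0`. -/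
theorem LiouvilleManifold.mfderiv_flow_L (Λ : LiouvilleManifold E W) (s : ℝ) (p : W) :
    (mfderiv 𝓘(ℝ, E) 𝓘(ℝ, E) (Λ.flow s) p (Λ.L p) : E) = Λ.L (Λ.flow s p) := by
  have key : ∀ t : ℝ, (mfderiv 𝓘(ℝ, E) 𝓘(ℝ, E) (Λ.flow s) (Λ.flow t p) (Λ.L (Λ.flow t p)) : E)
      = Λ.L (Λ.flow t (Λ.flow s p)) := fun t => by
    have h1 := (Λ.mdifferentiableAt_flow s (Λ.flow t p)).hasMFDerivAt.comp t
      (Λ.flow_generator p t)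
    have h2 : (Λ.flow s ∘ fun t => Λ.flow t p) = fun t => Λ.flow t (Λ.flow s p) := by
      funext r
      rw [Function.comp_apply, ← Λ.flow.map_add, ← Λ.flow.map_add, add_comm]
    rw [h2] at h1
    have h3 := DFunLike.congr_fun (hasMFDerivAt_unique h1 (Λ.flow_generator (Λ.flow s p) t)) (1 : ℝ)
    have h4 : ∀ w : E, ((1 : ℝ →L[ℝ] ℝ).smulRight w) 1 = w := fun w => by simp
    refine Eq.trans ?_ (h3.trans (h4 _))
    exact congrArg (mfderiv 𝓘(ℝ, E) 𝓘(ℝ, E) (Λ.flow s) (Λ.flow t p) : E →L[ℝ] E) (h4 _).symm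
  have h := key 0
  rwa [Λ.flow.map_zero_apply, Λ.flow.map_zero_apply] at h

/-- A flow line cannot enter the domain in forward time. At the last time outside it is on the
boundary, where the defining function is nonnegative and strictly increasing along `L`; yet it would
have to be negative just afterwards. -/
theorem IsStarShaped.flow_neg_mem {A : Set W} (hA : IsStarShaped Λ A) {p : W} (hp : p ∈ A)
    {s : ℝ} (hs : 0 ≤ s) : Λ.flow (-s) p ∈ A := by
  by_contra hx
  set x := Λ.flow (-s) p
  let γ : ℝ → W := fun t => Λ.flow t x
  have hγ : Continuous γ := Λ.flow.continuous continuous_id continuous_const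
  have hγ0 : γ 0 ∉ A := by simpa only [γ, Λ.flow.map_zero_apply] using hx
  have hγs : γ s ∈ A := by
    simp only [γ, x]
    rw [← Λ.flow.map_add]
    simpa using hp
  have hS : IsCompact (Icc 0 s ∩ γ ⁻¹' Aᶜ) :=
    isCompact_Icc.inter_right (hA.isOpen.isClosed_compl.preimage hγ)
  obtain ⟨t₀, ⟨⟨ht0, hts⟩, htA⟩, hmax⟩ := hS.exists_isGreatest ⟨0, ⟨le_rfl, hs⟩, hγ0⟩
  have hlt : t₀ < s := lt_of_le_of_ne hts (by rintro rfl; exact htA hγs)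
  have hafter : ∀ᶠ t in 𝓝[>] t₀, γ t ∈ A := by
    filter_upwards [Ioo_mem_nhdsGT hlt] with t ht
    by_contra hn
    exact absurd (hmax ⟨⟨ht0.trans ht.1.le, ht.2.le⟩, hn⟩) (not_le.2 ht.1)
  have hγt : Filter.Tendsto γ (𝓝[>] t₀) (𝓝 (γ t₀)) := hγ.continuousAt.mono_left nhdsWithin_le_nhds
  have hfr : γ t₀ ∈ frontier A :=
    ⟨mem_closure_of_tendsto hγt hafter, fun h => htA (interior_subset h)⟩
  obtain ⟨O, f, hO, hmem, hf, hAf, hpos⟩ := hA.boundary _ hfr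
  have hfd : MDifferentiableAt 𝓘(ℝ, E) 𝓘(ℝ, ℝ) f (γ t₀) :=
    (hf.contMDiffAt (hO.mem_nhds hmem)).mdifferentiableAt (by simp)
  have hd : HasDerivAt (f ∘ γ) (mvfderiv 𝓘(ℝ, E) f (γ t₀) (Λ.L (γ t₀))) t₀ := by
    let T : E →L[ℝ] ℝ := mfderiv 𝓘(ℝ, E) 𝓘(ℝ, ℝ) f (γ t₀)
    have h1 : HasFDerivAt (f ∘ γ) (T.comp ((1 : ℝ →L[ℝ] ℝ).smulRight (Λ.L (γ t₀) : E))) t₀ :=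
      hasMFDerivAt_iff_hasFDerivAt.1 (hfd.hasMFDerivAt.comp t₀ (Λ.flow_generator x t₀))
    refine h1.hasDerivAt.congr_deriv ?_
    have h2 : ∀ w : E, ((1 : ℝ →L[ℝ] ℝ).smulRight w) 1 = w := fun w => by simp
    exact congrArg T (h2 _)
  have hge : 0 ≤ f (γ t₀) := not_lt.1 fun h => htA ((hAf _ hmem).2 h)
  have hslope : ∀ᶠ t in 𝓝[>] t₀, 0 < slope (f ∘ γ) t₀ t :=
    ((hasDerivAt_iff_tendsto_slope.1 hd).mono_left
      (nhdsWithin_mono _ fun t ht => ne_of_gt ht)).eventually (lt_mem_nhds hpos)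
  obtain ⟨t, hsl, htA', htO, htt⟩ := (hslope.and (hafter.and ((hγt.eventually
    (hO.mem_nhds hmem)).and self_mem_nhdsWithin))).exists
  have hneg : f (γ t) < 0 := (hAf _ htO).1 htA'
  rw [slope_def_field, div_pos_iff_of_pos_right (sub_pos.2 htt)] at hsl
  simp only [Function.comp_apply] at hsl
  linarith

/-- A fiberwise star-shaped domain contains every sufficiently rescaled one. -/
theorem IsFiberwiseStarShaped.exists_rescale_subset {U V : Set (W × Circle)}
    (hU : IsFiberwiseStarShaped Λ U) (hV : IsFiberwiseStarShaped Λ V) :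
    ∃ k : ℕ, 0 < k ∧ rescale Λ U k ⊆ V := by
  have hK : IsCompact ((Prod.fst '' closure U) ×ˢ (univ : Set Circle)) :=
    (hU.isCompact_closure.image continuous_fst).prod isCompact_univ
  obtain ⟨S, hS⟩ : ∃ S : ℝ, ∀ x ∈ (Prod.fst '' closure U) ×ˢ (univ : Set Circle), ∀ r, S ≤ r →
      (Λ.flow (-r) x.1, x.2) ∈ V := by
    refine hK.induction_on (p := fun T => ∃ S : ℝ, ∀ x ∈ T, ∀ r, S ≤ r →
      (Λ.flow (-r) x.1, x.2) ∈ V) ⟨0, by simp⟩ ?_ ?_ ?_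
    · rintro s t hst ⟨S, hS⟩
      exact ⟨S, fun x hx => hS x (hst hx)⟩
    · rintro s t ⟨S, hS⟩ ⟨T, hT⟩
      exact ⟨max S T, fun x hx r hr => hx.elim (fun h => hS x h r ((le_max_left _ _).trans hr))
        fun h => hT x h r ((le_max_right _ _).trans hr)⟩
    · intro x _
      obtain ⟨s, _, hs⟩ := (hV.fiber x.2).exhausts x.1
      -- Being in `V` after backward time `s` is an open condition, and `flow_neg_mem` makes it
      -- persist for all later times; this gives a locally uniform bound.
      refine ⟨{y | (Λ.flow (-s) y.1, y.2) ∈ V}, mem_nhdsWithin_of_mem_nhds ?_, s,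
        fun y hy r hr => ?_⟩
      · exact (hV.isOpen.preimage (((Λ.contMDiff_flow (-s)).continuous.comp continuous_fst).prodMk
          continuous_snd)).mem_nhds hs
      · have h := (hV.fiber y.2).flow_neg_mem (p := Λ.flow (-s) y.1) hy (sub_nonneg.2 hr)
        rw [← Λ.flow.map_add] at h
        have e : -(r - s) + -s = -r := by ring
        rwa [e] at h
  -- With `k = ⌈e^S⌉` the flow time `ln k` is at least `S`.
  have hk : 0 < ⌈Real.exp S⌉₊ := Nat.ceil_pos.2 (Real.exp_pos S)
  refine ⟨⌈Real.exp S⌉₊, hk, fun x hx => ?_⟩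
  have h := hS (Λ.flow (Real.log ⌈Real.exp S⌉₊) x.1, x.2) ⟨⟨_, subset_closure hx, rfl⟩, trivial⟩
    (Real.log ⌈Real.exp S⌉₊) ((Real.le_log_iff_exp_le (by positivity)).2 (Nat.le_ceil _))
  rw [← Λ.flow.map_add] at h
  simpa using h

/-- The flow preserves `L`, so a defining function pulled back by it has the same derivative along
`L`. -/
theorem IsStarShaped.preimage_flow [T2Space W] {A : Set W} (hA : IsStarShaped Λ A) (s : ℝ) :
    IsStarShaped Λ (Λ.flow s ⁻¹' A) where
  isOpen := hA.isOpen.preimage (Λ.contMDiff_flow s).continuous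
  isCompact_closure := by
    refine (hA.isCompact_closure.image (Λ.contMDiff_flow (-s)).continuous).of_isClosed_subset
      isClosed_closure (closure_minimal (fun p hp => ⟨Λ.flow s p, subset_closure hp, ?_⟩)
        (hA.isCompact_closure.image (Λ.contMDiff_flow (-s)).continuous).isClosed)
    rw [← Λ.flow.map_add]
    simp
  boundary p hp := by
    have hc := (Λ.contMDiff_flow s).continuous
    obtain ⟨O, f, hO, hmem, hf, hAf, hpos⟩ := hA.boundary _ (hc.frontier_preimage_subset A hp)
    refine ⟨Λ.flow s ⁻¹' O, f ∘ Λ.flow s, hO.preimage hc, hmem,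
      hf.comp (Λ.contMDiff_flow s).contMDiffOn fun _ h => h, fun q hq => hAf _ hq, ?_⟩
    rw [mvfderiv_comp p ((hf.contMDiffAt (hO.mem_nhds hmem)).mdifferentiableAt (by simp))
      (Λ.mdifferentiableAt_flow s p)]
    exact hpos.trans_eq (congrArg (mvfderiv 𝓘(ℝ, E) f (Λ.flow s p) : E →L[ℝ] ℝ)
      (Λ.mfderiv_flow_L s p).symm)
  exhausts p := by
    obtain ⟨r, hr, h⟩ := hA.exhausts (Λ.flow s p)
    refine ⟨r, hr, ?_⟩
    rw [← Λ.flow.map_add, add_comm, Λ.flow.map_add] at h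
    exact h

theorem IsFiberwiseStarShaped.rescale [T2Space W] {U : Set (W × Circle)}
    (hU : IsFiberwiseStarShaped Λ U) (k : ℕ) : IsFiberwiseStarShaped Λ (rescale Λ U k) where
  isOpen := hU.isOpen.preimage (continuous_coverMap Λ k)
  isCompact_closure :=
    (isCompact_preimage_coverMap Λ k hU.isCompact_closure isClosed_closure).of_isClosed_subset
      isClosed_closure ((continuous_coverMap Λ k).closure_preimage_subset U)
  boundary x hx := by
    have hc := continuous_coverMap Λ k
    obtain ⟨O, f, hO, hmem, hf, hUf, v, hv⟩ := hU.boundary _ (hc.frontier_preimage_subset U hx)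
    let s := Real.log k
    -- The transverse fiber vector is pulled back by the inverse of the fiberwise diffeomorphism
    -- `φ_L^s`.
    let v' : TangentSpace 𝓘(ℝ, E) x.1 :=
      mfderiv 𝓘(ℝ, E) 𝓘(ℝ, E) (Λ.flow (-s)) (Λ.flow s x.1) v
    refine ⟨coverMap Λ k ⁻¹' O, f ∘ coverMap Λ k, hO.preimage hc, hmem,
      hf.comp (contMDiff_coverMap Λ k).contMDiffOn fun _ h => h, fun q hq => hUf _ hq, v', ?_⟩
    have hvv : (mfderiv 𝓘(ℝ, E) 𝓘(ℝ, E) (Λ.flow s) x.1 v' : E) = v := by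
      have h1 := mfderiv_comp (Λ.flow s x.1) (Λ.mdifferentiableAt_flow s (Λ.flow (-s) (Λ.flow s x.1)))
        (Λ.mdifferentiableAt_flow (-s) (Λ.flow s x.1))
      have h2 : Λ.flow s ∘ Λ.flow (-s) = id := by
        funext p; rw [Function.comp_apply, ← Λ.flow.map_add]; simp
      have h3 : Λ.flow (-s) (Λ.flow s x.1) = x.1 := by rw [← Λ.flow.map_add]; simp
      rw [h2, mfderiv_id] at h1
      have h4 := DFunLike.congr_fun h1 v
      exact (congrArg (fun p => (mfderiv 𝓘(ℝ, E) 𝓘(ℝ, E) (Λ.flow s) p : E →L[ℝ] E) v') h3).symm.trans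
        h4.symm
    rw [mvfderiv_comp x ((hf.contMDiffAt (hO.mem_nhds hmem)).mdifferentiableAt (by simp))
      (mdifferentiableAt_coverMap Λ k x)]
    refine fun h => hv (Eq.trans ?_ h)
    refine congrArg (mvfderiv (𝓘(ℝ, E).prod (𝓡 1)) f (coverMap Λ k x) :
      E × EuclideanSpace ℝ (Fin 1) →L[ℝ] ℝ) ?_
    refine Eq.trans ?_ (mfderiv_coverMap Λ k x (v', 0)).symm
    exact Prod.ext hvv.symm (map_zero _).symm
  fiber z := (hU.fiber (z ^ k)).preimage_flow (Real.log k)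

end StarShaped

/-! ### Calculus of embeddings up to contact isotopy. -/

section Embeds

variable {E : Type*} [NormedAddCommGroup E] [NormedSpace ℝ E]
  {W : Type*} [TopologicalSpace W] [ChartedSpace E W] {Λ : LiouvilleManifold E W}

theorem embeds_of_subset {U V : Set (W × Circle)} {k l : ℕ} (h : rescale Λ U k ⊆ rescale Λ V l) :
    Embeds Λ U V k l :=
  ⟨fun _ => 1, isContactIsotopy_one, by simpa using h⟩

theorem Embeds.trans {U V Z : Set (W × Circle)} {k l n : ℕ} (h : Embeds Λ U V k l)
    (h' : Embeds Λ V Z l n) : Embeds Λ U Z k n := by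
  obtain ⟨φ, hφ, h⟩ := h
  obtain ⟨ψ, hψ, h'⟩ := h'
  refine ⟨_, hψ.mul hφ, ?_⟩
  rintro _ ⟨x, hx, rfl⟩
  exact h' ⟨_, h ⟨x, hx, rfl⟩, rfl⟩

theorem embeds_rescale_left {U V : Set (W × Circle)} {j k l : ℕ} (hj : 0 < j) (hk : 0 < k) :
    Embeds Λ (rescale Λ U j) V k l ↔ Embeds Λ U V (j * k) l := by
  simp only [Embeds, rescale_mul Λ U hj hk]

theorem embeds_rescale_right {U V : Set (W × Circle)} {j k l : ℕ} (hj : 0 < j) (hl : 0 < l) :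
    Embeds Λ U (rescale Λ V j) k l ↔ Embeds Λ U V k (j * l) := by
  simp only [Embeds, rescale_mul Λ V hj hl]

/-- Elements of `Cont₀` are inverted by elements of `Cont₀`. -/
theorem inv_mem_Cont₀ {φ : Equiv.Perm (W × Circle)} (hφ : φ ∈ Cont₀ Λ) : φ⁻¹ ∈ Cont₀ Λ := by
  obtain ⟨φ, hφ, rfl⟩ := hφ
  exact ⟨_, hφ.inv, rfl⟩

variable [T2Space W] [IsManifold 𝓘(ℝ, E) ∞ W]

/-- Lift the isotopy through `τ_m` and use `τ_k ∘ τ_m = τ_{km}`. This is what lets embeddings with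
different middle rescalings be composed. -/
theorem Embeds.mul_right {U V : Set (W × Circle)} {k l : ℕ} (h : Embeds Λ U V k l) (hk : 0 < k)
    (hl : 0 < l) {m : ℕ} (hm : 0 < m) : Embeds Λ U V (k * m) (l * m) := by
  obtain ⟨φ, hφ, h⟩ := h
  obtain ⟨φ', hφ', hlift⟩ := hφ.exists_lift hm
  refine ⟨φ', hφ', ?_⟩
  rintro _ ⟨x, hx, rfl⟩
  rw [rescale, mem_preimage, ← coverMap_mul Λ hl hm, hlift]
  rw [rescale, mem_preimage, ← coverMap_mul Λ hk hm] at hx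
  exact h ⟨_, hx, rfl⟩

/-- The lift of the isotopy through `τ_k` carries `U/k` into `φ(U)/k`. -/
theorem embeds_image {φ : Equiv.Perm (W × Circle)} (hφ : φ ∈ Cont₀ Λ) (U : Set (W × Circle))
    {k : ℕ} (hk : 0 < k) : Embeds Λ U (φ '' U) k k := by
  obtain ⟨φ, hφ, rfl⟩ := hφ
  obtain ⟨φ', hφ', hlift⟩ := hφ.exists_lift hk
  refine ⟨φ', hφ', ?_⟩
  rintro _ ⟨x, hx, rfl⟩
  rw [rescale, mem_preimage, hlift]
  exact ⟨_, hx, rfl⟩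

theorem embeds_of_image {φ : Equiv.Perm (W × Circle)} (hφ : φ ∈ Cont₀ Λ) (U : Set (W × Circle))
    {k : ℕ} (hk : 0 < k) : Embeds Λ (φ '' U) U k k := by
  have h := embeds_image (inv_mem_Cont₀ hφ) (φ '' U) hk
  rwa [image_image, show (fun x => φ⁻¹ (φ x)) = id by funext x; simp, image_id] at h

theorem embeds_image_iff {φ ψ : Equiv.Perm (W × Circle)} (hφ : φ ∈ Cont₀ Λ) (hψ : ψ ∈ Cont₀ Λ)
    {U V : Set (W × Circle)} {k l : ℕ} (hk : 0 < k) (hl : 0 < l) :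
    Embeds Λ (φ '' U) (ψ '' V) k l ↔ Embeds Λ U V k l :=
  ⟨fun h => ((embeds_image hφ U hk).trans h).trans (embeds_of_image hψ V hl),
    fun h => ((embeds_of_image hφ U hk).trans h).trans (embeds_image hψ V hl)⟩

theorem rhoC_image {φ ψ : Equiv.Perm (W × Circle)} (hφ : φ ∈ Cont₀ Λ) (hψ : ψ ∈ Cont₀ Λ)
    (U V : Set (W × Circle)) : rhoC Λ (φ '' U) (ψ '' V) = rhoC Λ U V := by
  unfold rhoC
  congr 1
  ext r
  exact exists_congr fun k => exists_congr fun l => and_congr_right fun hk =>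
    and_congr_right fun hl => and_congr_left fun _ => embeds_image_iff hφ hψ hk hl

theorem dCBM_image {φ ψ : Equiv.Perm (W × Circle)} (hφ : φ ∈ Cont₀ Λ) (hψ : ψ ∈ Cont₀ Λ)
    (U V : Set (W × Circle)) : dCBM Λ (φ '' U) (ψ '' V) = dCBM Λ U V := by
  simp only [dCBM, gammaCBM, rhoC_image hφ hψ, rhoC_image hψ hφ]

end Embeds

/-! ### The numbers `ρ_c` and the resulting distance. -/

section Rho

variable {E : Type*} [NormedAddCommGroup E] [NormedSpace ℝ E]
  {W : Type*} [TopologicalSpace W] [ChartedSpace E W] {Λ : LiouvilleManifold E W}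

theorem rhoC_le {U V : Set (W × Circle)} {k l : ℕ} (hk : 0 < k) (hl : 0 < l)
    (h : Embeds Λ U V k l) : rhoC Λ U V ≤ (k : ℝ≥0∞) / l :=
  sInf_le ⟨k, l, hk, hl, h, rfl⟩

theorem rhoC_ne_top {U V : Set (W × Circle)} (hU : IsFiberwiseStarShaped Λ U)
    (hV : IsFiberwiseStarShaped Λ V) : rhoC Λ U V ≠ ⊤ := by
  obtain ⟨k, hk, h⟩ := hU.exists_rescale_subset hV
  refine ne_top_of_le_ne_top ?_
    (rhoC_le (l := 1) hk one_pos (embeds_of_subset (by rwa [rescale_one])))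
  simp

theorem rhoC_self_le_one (U : Set (W × Circle)) : rhoC Λ U U ≤ 1 := by
  simpa using rhoC_le (Λ := Λ) (U := U) (V := U) one_pos one_pos (embeds_of_subset subset_rfl)

theorem le_of_embeds_of_not_isSqueezable {U : Set (W × Circle)} (hU : ¬ IsSqueezable Λ U) {k l : ℕ}
    (hk : 0 < k) (h : Embeds Λ U U k l) : l ≤ k :=
  not_lt.1 fun hlt => hU ⟨k, l, hk, hlt, h⟩

/-- Squeezing `U/j` from `k` to `l` is squeezing `U` from `jk` to `jl`. -/
theorem rescale_not_isSqueezable {U : Set (W × Circle)} (hU : ¬ IsSqueezable Λ U) {j : ℕ}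
    (hj : 0 < j) : ¬ IsSqueezable Λ (rescale Λ U j) := by
  rintro ⟨k, l, hk, hkl, h⟩
  rw [embeds_rescale_left hj hk, embeds_rescale_right hj (hk.trans hkl)] at h
  exact hU ⟨j * k, j * l, by positivity, Nat.mul_lt_mul_of_pos_left hkl hj, h⟩

/-- A non-squeezable domain cannot be squeezed into a rescaling of itself. -/
theorem le_rhoC_rescale {U : Set (W × Circle)} (hU : ¬ IsSqueezable Λ U) {j : ℕ} (hj : 0 < j) :
    (j : ℝ≥0∞) ≤ rhoC Λ U (rescale Λ U j) := by
  refine le_sInf ?_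
  rintro _ ⟨k, l, hk, hl, h, rfl⟩
  -- As `(U/j)/l = U/(jl)`, non-squeezability forces `jl ≤ k`.
  rw [embeds_rescale_right hj hl] at h
  have hle := le_of_embeds_of_not_isSqueezable hU hk h
  rw [ENNReal.le_div_iff_mul_le (by simp [hl.ne']) (by simp)]
  exact_mod_cast hle

theorem one_le_rhoC_self {U : Set (W × Circle)} (hU : ¬ IsSqueezable Λ U) : 1 ≤ rhoC Λ U U := by
  simpa [rescale_one] using le_rhoC_rescale hU one_pos

theorem gammaCBM_comm (U V : Set (W × Circle)) : gammaCBM Λ U V = gammaCBM Λ V U := max_comm _ _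

theorem gammaCBM_ne_top {U V : Set (W × Circle)} (hU : U ∈ nonSqueezable Λ)
    (hV : V ∈ nonSqueezable Λ) : gammaCBM Λ U V ≠ ⊤ :=
  max_ne_top (rhoC_ne_top hU.1 hV.1) (rhoC_ne_top hV.1 hU.1)

/-- The distance on non-squeezable domains as a real number. -/
noncomputable def realDist (Λ : LiouvilleManifold E W) (U V : Set (W × Circle)) : ℝ :=
  Real.log (gammaCBM Λ U V).toReal

theorem realDist_rescale_pos {U : Set (W × Circle)} (hU : U ∈ nonSqueezable Λ)
    (hU' : rescale Λ U 2 ∈ nonSqueezable Λ) : 0 < realDist Λ U (rescale Λ U 2) := by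
  have h1 : (2 : ℝ≥0∞) ≤ gammaCBM Λ U (rescale Λ U 2) :=
    (le_rhoC_rescale hU.2 two_pos).trans (le_max_left _ _)
  have h2 := ENNReal.toReal_mono (gammaCBM_ne_top hU hU') h1
  refine Real.log_pos (lt_of_lt_of_le ?_ h2)
  simp

variable [T2Space W] [IsManifold 𝓘(ℝ, E) ∞ W]

/-- Finiteness of both factors excludes the product `0 · ∞`, which is `0` in `ℝ≥0∞`. -/
theorem rhoC_triangle {U V Z : Set (W × Circle)} (hUV : rhoC Λ U V ≠ ⊤) (hVZ : rhoC Λ V Z ≠ ⊤) :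
    rhoC Λ U Z ≤ rhoC Λ U V * rhoC Λ V Z := by
  have key : ∀ k l m n : ℕ, 0 < k → 0 < l → 0 < m → 0 < n → Embeds Λ U V k l → Embeds Λ V Z m n →
      rhoC Λ U Z ≤ (k : ℝ≥0∞) / l * ((m : ℝ≥0∞) / n) := by
    intro k l m n hk hl hm hn h h'
    -- `U/(km)` goes into `V/(lm)`, which goes into `Z/(nl)`; the ratio is the product of the two
    -- given ones.
    have h1 := h.mul_right hk hl hm
    have h2 := h'.mul_right hm hn hl
    rw [mul_comm m l] at h2
    refine (rhoC_le (by positivity) (by positivity) (h1.trans h2)).trans_eq ?_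
    rw [Nat.cast_mul, Nat.cast_mul, div_eq_mul_inv, div_eq_mul_inv, div_eq_mul_inv,
      ENNReal.mul_inv (by simp) (by simp)]
    ring
  have key' : ∀ m n : ℕ, 0 < m → 0 < n → Embeds Λ V Z m n →
      rhoC Λ U Z ≤ rhoC Λ U V * ((m : ℝ≥0∞) / n) := by
    intro m n hm hn h'
    have h0 : (m : ℝ≥0∞) / n ≠ 0 := by simp [hm.ne']
    have ht : (m : ℝ≥0∞) / n ≠ ⊤ := ENNReal.div_ne_top (by simp) (by simp [hn.ne'])
    rw [← ENNReal.div_le_iff h0 ht]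
    refine le_sInf ?_
    rintro _ ⟨k, l, hk, hl, h, rfl⟩
    rw [ENNReal.div_le_iff h0 ht]
    exact key k l m n hk hl hm hn h h'
  -- When `ρ_c(U, V) = 0` division by it is unavailable, but one embedding of `V` into `Z` suffices;
  -- it exists because `ρ_c(V, Z)` is finite.
  rcases eq_or_ne (rhoC Λ U V) 0 with h0 | h0
  · have hne : {r | ∃ k l : ℕ, 0 < k ∧ 0 < l ∧ Embeds Λ V Z k l ∧
        r = (k : ℝ≥0∞) / (l : ℝ≥0∞)}.Nonempty := by
      by_contra hn
      rw [not_nonempty_iff_eq_empty] at hn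
      exact hVZ (by rw [rhoC, hn, sInf_empty])
    obtain ⟨_, m, n, hm, hn, h', rfl⟩ := hne
    simpa [h0] using key' m n hm hn h'
  · rw [mul_comm, ← ENNReal.div_le_iff h0 hUV]
    refine le_sInf ?_
    rintro _ ⟨m, n, hm, hn, h', rfl⟩
    rw [ENNReal.div_le_iff h0 hUV, mul_comm]
    exact key' m n hm hn h'

/-- If both `ρ_c(U, V)` and `ρ_c(V, U)` were below `1`, so would be `ρ_c(U, U)`, and `U` would be
squeezable. -/
theorem one_le_gammaCBM {U V : Set (W × Circle)} (hU : U ∈ nonSqueezable Λ)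
    (hV : V ∈ nonSqueezable Λ) : 1 ≤ gammaCBM Λ U V := by
  by_contra! h
  have h1 := max_lt_iff.1 h
  have h2 := (one_le_rhoC_self hU.2).trans
    (rhoC_triangle (rhoC_ne_top hU.1 hV.1) (rhoC_ne_top hV.1 hU.1))
  exact absurd h2 (not_le.2 ((mul_le_of_le_one_right' h1.2.le).trans_lt h1.1))

theorem gammaCBM_self {U : Set (W × Circle)} (hU : U ∈ nonSqueezable Λ) : gammaCBM Λ U U = 1 :=
  le_antisymm (max_le (rhoC_self_le_one U) (rhoC_self_le_one U)) (one_le_gammaCBM hU hU)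

theorem gammaCBM_triangle {U V Z : Set (W × Circle)} (hU : U ∈ nonSqueezable Λ)
    (hV : V ∈ nonSqueezable Λ) (hZ : Z ∈ nonSqueezable Λ) :
    gammaCBM Λ U Z ≤ gammaCBM Λ U V * gammaCBM Λ V Z := by
  refine max_le ?_ ?_
  · exact (rhoC_triangle (rhoC_ne_top hU.1 hV.1) (rhoC_ne_top hV.1 hZ.1)).trans
      (mul_le_mul' (le_max_left _ _) (le_max_left _ _))
  · rw [mul_comm]
    exact (rhoC_triangle (rhoC_ne_top hZ.1 hV.1) (rhoC_ne_top hV.1 hU.1)).trans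
      (mul_le_mul' (le_max_right _ _) (le_max_right _ _))

theorem one_le_gammaCBM_toReal {U V : Set (W × Circle)} (hU : U ∈ nonSqueezable Λ)
    (hV : V ∈ nonSqueezable Λ) : 1 ≤ (gammaCBM Λ U V).toReal := by
  simpa using ENNReal.toReal_mono (gammaCBM_ne_top hU hV) (one_le_gammaCBM hU hV)

theorem dCBM_eq_realDist {U V : Set (W × Circle)} (hU : U ∈ nonSqueezable Λ)
    (hV : V ∈ nonSqueezable Λ) : dCBM Λ U V = realDist Λ U V :=
  ENNReal.log_pos_real' (one_pos.trans_le (one_le_gammaCBM_toReal hU hV))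

theorem realDist_triangle {U V Z : Set (W × Circle)} (hU : U ∈ nonSqueezable Λ)
    (hV : V ∈ nonSqueezable Λ) (hZ : Z ∈ nonSqueezable Λ) :
    realDist Λ U Z ≤ realDist Λ U V + realDist Λ V Z := by
  have h1 := one_le_gammaCBM_toReal hU hV
  have h2 := one_le_gammaCBM_toReal hV hZ
  have h3 := one_le_gammaCBM_toReal hU hZ
  rw [realDist, realDist, realDist, ← Real.log_mul (by positivity) (by positivity),
    ← ENNReal.toReal_mul]
  exact Real.log_le_log (by positivity) (ENNReal.toReal_mono
    (ENNReal.mul_ne_top (gammaCBM_ne_top hU hV) (gammaCBM_ne_top hV hZ))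
    (gammaCBM_triangle hU hV hZ))

end Rho

end ContactBM
-- The pseudo-metric and its invariance.
theorem mainTheorem2 {E : Type*} [NormedAddCommGroup E] [NormedSpace ℝ E] [FiniteDimensional ℝ E]
    {W : Type*} [TopologicalSpace W] [T2Space W] [SecondCountableTopology W]
    [ChartedSpace E W] [IsManifold 𝓘(ℝ, E) ∞ W]
    (Λ : ContactBM.LiouvilleManifold E W) (hN : (ContactBM.nonSqueezable Λ).Nonempty) :
    (∃ D : PseudoMetricSpace (ContactBM.nonSqueezable Λ),
      (∀ U V : ContactBM.nonSqueezable Λ,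
        ContactBM.dCBM Λ (U : Set (W × Circle)) (V : Set (W × Circle))
          = ((D.dist U V : ℝ) : EReal)) ∧
      ∃ U V : ContactBM.nonSqueezable Λ, 0 < D.dist U V) ∧
    ∀ φ ∈ ContactBM.Cont₀ Λ, ∀ ψ ∈ ContactBM.Cont₀ Λ,
      ∀ U ∈ ContactBM.nonSqueezable Λ, ∀ V ∈ ContactBM.nonSqueezable Λ,
        ContactBM.dCBM Λ (φ '' U) (ψ '' V) = ContactBM.dCBM Λ U V := by
  refine ⟨?_, fun φ hφ ψ hψ U _ V _ => ContactBM.dCBM_image hφ hψ U V⟩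
  let D : PseudoMetricSpace (ContactBM.nonSqueezable Λ) :=
    { dist := fun U V => ContactBM.realDist Λ U V
      dist_self := fun U => by
        simp [ContactBM.realDist, ContactBM.gammaCBM_self U.2]
      dist_comm := fun U V => by
        simp only [ContactBM.realDist, ContactBM.gammaCBM_comm]
      dist_triangle := fun U V Z => ContactBM.realDist_triangle U.2 V.2 Z.2 }
  refine ⟨D, fun U V => ContactBM.dCBM_eq_realDist U.2 V.2, ?_⟩
  obtain ⟨U, hU⟩ := hN
  have hU' : ContactBM.rescale Λ U 2 ∈ ContactBM.nonSqueezable Λ :=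
    ⟨hU.1.rescale 2, ContactBM.rescale_not_isSqueezable hU.2 two_pos⟩
  exact ⟨⟨U, hU⟩, ⟨_, hU'⟩, ContactBM.realDist_rescale_pos hU hU'⟩
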